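/- **Notation.** Let $d\ge 2$ be an integer. Row vectors in $\mathbb{C}^{2d+1}$ and $(2d+1)\times(2d+1)$ matrices are indexed by the integers $-d,\dots,d$. Let $\mathbf v^d_j$ be the row vector with entry $1$ at index $j$ and $0$ elsewhere, and for a sign $\pm$ set $\mathbf u^{d,\pm}_j=\tfrac12\bigl(\mathbf v^d_j\pm(-1)^d\mathbf v^d_{-j}\bigr)$. Let $\mathcal D^d=(\mathcal D^d_{m',m})$ be the Wigner matrix on $SO(3,\mathbb R)$. With the rotation $R_z(\theta)$ by $\theta$ about the third axis and $R_y(\beta)=\begin{pmatrix}\cos\beta&0&\sin\beta\\0&1&0\\-\sin\beta&0&\cos\beta\end{pmatrix}$, $$\mathcal D^d_{m',m}\bigl(R_z(\alpha)R_y(\beta)R_z(\gamma)\bigr)=e^{-im'\alpha}\,\mathrm d^d_{m',m}(\cos\beta)\,e^{-im\gamma},\qquad 0\le\beta\le\pi,$$ $$\mathrm d^d_{m',m}(x)=2^{-m}\sqrt{\tfrac{(d+m)!\,(d-m)!}{(d+m')!\,(d-m')!}}\,(1-x)^{\frac{m-m'}2}(1+x)^{\frac{m+m'}2}P^{(m-m',\,m+m')}_{d-m}(x),$$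 where $P_n^{(a,b)}(x)=\sum_s\binom{n+a}{n-s}\binom{n+b}{s}\bigl(\tfrac{x-1}2\bigr)^s\bigl(\tfrac{x+1}2\bigr)^{n-s}$ is the Jacobi polynomial. (At $x=\pm1$ the product defining $\mathrm d^d_{m',m}$ is read by continuity.) Put $$w_2=-\begin{pmatrix}0&1&0\\1&0&0\\0&0&1\end{pmatrix},\quad w_3=-\begin{pmatrix}1&0&0\\0&0&1\\0&1&0\end{pmatrix},\quad w_4=w_3w_2,\quad w_5=w_2w_3,\quad w_l=w_2w_3w_2,\quad v=\mathrm{diag}(-1,1,-1).$$ For $\mu\in\mathbb C^3$ with $\mu_1+\mu_2+\mu_3=0$ and $w$ one of these Weyl elements, $\mu^w$ is the permutation of $\mu$ with $p_{\mu^w}(a)=p_\mu(waw^{-1})$, where $p_\mu(\mathrm{diag}(a_1,a_2,a_3))=\prod_i|a_i|^{\mu_i}$; so $\mu^{w_3}=(\mu_1,\mu_3,\mu_2)$ and $\mu^{w_5}=(\mu_2,\mu_3,\mu_1)$. Let $\Gamma^d(u)$ be the diagonal matrix with entries $\Gamma\bigl(\tfrac{1-m+u}2\bigr)/\Gamma\bigl(\tfrac{1-m-u}2\bigr)$,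 $|m|\le d$, each understood as a meromorphic function of $u$ (removable singularities are removed). The intertwining matrices are $$T^d(w_2,\mu)=\pi^{\mu_1-\mu_2}\,\Gamma^d(\mu_2-\mu_1),\qquad T^d(w_3,\mu)=\pi^{\mu_2-\mu_3}\,\mathcal D^d(vw_l)\,\Gamma^d(\mu_3-\mu_2)\,\mathcal D^d(w_lv),$$ $$T^d(w_4,\mu)=T^d(w_3,\mu)\,T^d(w_2,\mu^{w_3}).$$ **The vectors $g_2,g_3,g_4$.** They depend on $d$ and $\mu$. Put $g^d_{2,0,0}=\tfrac12$, and for $0<2j+k\le d$ ($j,k\ge0$) $$g^d_{2,k,2j+k}=(-1)^j\prod_{i=0}^{j-1}\frac{\sqrt{(d-1-2i-k)(d-2i-k)}\,(3\mu_3+2d-1+2i+k)}{\sqrt{(d+1+2i+k)(d+2+2i+k)}\,(\mu_1-\mu_2-1-2i-k)}.$$ For $\delta\in\{0,1\}$ and a sign $\varepsilon$ let $$g_2^{d,\delta,\varepsilon}=\sum_{0\le 2j+\delta\le d}g^d_{2,\delta,2j+\delta}\,\mathbf u^{d,\varepsilon}_{2j+\delta},\qquad g_3^{d,\delta,\varepsilon}=\sum_{0\le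 2j+\delta\le d}g^d_{3,\delta,2j+\delta}\,\mathbf u^{d,\varepsilon}_{2j+\delta},$$ where $g^d_{3,\delta,m}=g^d_{2,\delta,m}$ for $m<d$, while $g^d_{3,\delta,d}=c\,g^d_{2,\delta,d-2}/\sqrt{d(2d-1)}$ for $d\equiv\delta\pmod 2$, with $c=1$ if $d\ge3$ and $c=2$ if $d=2$. For $d$ odd and $\kappa=\frac{d+1}2$ let $$g_4^{d,\varepsilon}=\sum_{\kappa\le 2j+\kappa\le d}g^d_{2,\kappa,2j+\kappa}\,\mathbf u^{d,\varepsilon}_{2j+\kappa}.$$ **Proposition.** Let $d\ge2$, let $t$ be real, and let $C$ denote a non-zero constant, depending on $d$ and $\mu$, whose value may differ between occurrences. 1. If $\mu=\bigl(\tfrac{d-1}2+it,\,-2it,\,-\tfrac{d-1}2+it\bigr)$ with $d$ even or $t\ne0$, then with $\varepsilon=(-1)^d$ $$g_2^{d,0,\varepsilon}=C\,\mathbf u^{d,\varepsilon}_d\,T^d(w_3,\mu^{w_3}),\qquad g_2^{d,1,-\varepsilon}=C\,\mathbf u^{d,-\varepsilon}_d\,T^d(w_3,\mu^{w_3}).$$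 2. If $\mu=\bigl(\tfrac{d-1}2,0,-\tfrac{d-1}2\bigr)$ with $d\equiv1\pmod4$, then $$g_2^{d,0,-}=C\,\mathbf u^{d,-}_d\,T^d(w_3,\mu^{w_3}),\qquad g_4^{d,+}=C\,\mathbf u^{d,+}_d\,T^d(w_3,\mu^{w_3}),\qquad g_4^{d,-}=C\,\mathbf u^{d,+}_d\,T^d(w_4,\mu^{w_5}).$$ 3. If $\mu=\bigl(\tfrac{d-1}2,0,-\tfrac{d-1}2\bigr)$ with $d\equiv3\pmod4$, then $$g_2^{d,1,+}=C\,\mathbf u^{d,+}_d\,T^d(w_3,\mu^{w_3}),\qquad g_4^{d,-}=C\,\mathbf u^{d,-}_d\,T^d(w_3,\mu^{w_3}),\qquad g_4^{d,+}=C\,\mathbf u^{d,+}_{d-1}\,T^d(w_4,\mu^{w_5}).$$ 4. If $\mu=(d-1,0,1-d)$, then with $\varepsilon=(-1)^d$ $$g_3^{d,1,\varepsilon}=C\,\mathbf u^{d,\varepsilon}_{d-1}\,T^d(w_3,\mu^{w_3}),\qquad g_3^{d,0,\varepsilon}=C\,\mathbf u^{d,\varepsilon}_d\,T^d(w_3,\mu^{w_3}).$$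 -/

import Mathlib

open Matrix

/-! ### Wigner matrices on `K = SO(3, ℝ)` -/

/-- The index set `-d, …, d` of the entries of vectors and matrices of weight `d`. -/
abbrev WIdx (d : ℕ) : Type := ↥(Finset.Icc (-(d : ℤ)) (d : ℤ))

/-- The rotation `k(θ, 0, 0)` about the third axis. -/
noncomputable def rotZ (θ : ℝ) : Matrix (Fin 3) (Fin 3) ℝ :=
  !![Real.cos θ, -Real.sin θ, 0; Real.sin θ, Real.cos θ, 0; 0, 0, 1]

/-- The Weyl element `w₂`. -/
def weylW2 : Matrix (Fin 3) (Fin 3) ℝ := -!![0, 1, 0; 1, 0, 0; 0, 0, 1]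

/-- The Weyl element `w₃`. -/
def weylW3 : Matrix (Fin 3) (Fin 3) ℝ := -!![1, 0, 0; 0, 0, 1; 0, 1, 0]

/-- The Weyl element `w₄`. -/
def weylW4 : Matrix (Fin 3) (Fin 3) ℝ := !![0, 1, 0; 0, 0, 1; 1, 0, 0]

/-- The Weyl element `w₅`. -/
def weylW5 : Matrix (Fin 3) (Fin 3) ℝ := !![0, 0, 1; 1, 0, 0; 0, 1, 0]

/-- The long Weyl element `w_l`. -/
def weylWl : Matrix (Fin 3) (Fin 3) ℝ := -!![0, 0, 1; 0, 1, 0; 1, 0, 0]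

/-- The diagonal orthogonal matrix `v₋₋ = diag(-1, 1, -1)`. -/
def vMinusMinus : Matrix (Fin 3) (Fin 3) ℝ := !![-1, 0, 0; 0, 1, 0; 0, 0, -1]

/-- The rotation `k(α, β, γ)` with `Z`-`Y`-`Z` Euler angles `α, β, γ`. -/
noncomputable def eulerRot (α β γ : ℝ) : Matrix (Fin 3) (Fin 3) ℝ :=
  rotZ α * weylW3 * rotZ (-β) * weylW3 * rotZ γ

/-- The entry `𝒹^d_{m',m}(cos β) = 𝒟^d_{m',m}(k(0, β, 0))`, `0 ≤ β ≤ π`. This is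
`2^{-m} √((d+m)!(d-m)!/((d+m')!(d-m')!)) (1-x)^{(m-m')/2} (1+x)^{(m+m')/2} P_{d-m}^{(m-m',m+m')}(x)`
at `x = cos β`, with the Jacobi polynomial written out as
`P_n^{(a,b)}(x) = ∑ₛ C(n+a, n-s) C(n+b, s) ((x-1)/2)^s ((x+1)/2)^{n-s}`
and `1 - x = 2 sin²(β/2)`, `1 + x = 2 cos²(β/2)`.
The exponents below are nonnegative whenever the binomial coefficients are nonzero. -/
noncomputable def wignerSmall (d : ℕ) (m' m : ℤ) (β : ℝ) : ℝ :=
  Real.sqrt ((((d + m).toNat.factorial * (d - m).toNat.factorial : ℕ) : ℝ) /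
      (((d + m').toNat.factorial * (d - m').toNat.factorial : ℕ) : ℝ)) *
    ∑ s ∈ Finset.range ((d - m).toNat + 1),
      (-1 : ℝ) ^ s * ((d - m').toNat.choose (d - m - s).toNat : ℝ) * ((d + m').toNat.choose s : ℝ) *
        Real.sin (β / 2) ^ (m - m' + 2 * s).toNat * Real.cos (β / 2) ^ (2 * d - m + m' - 2 * s).toNat

/-- The Wigner matrix `𝒟^d(k(α, β, γ))` in terms of Euler angles: its entries are
`e^{-i m' α} 𝒹^d_{m',m}(cos β) e^{-i m γ}`. -/
noncomputable def wignerEuler (d : ℕ) (α β γ : ℝ) : Matrix (WIdx d) (WIdx d) ℂ :=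
  fun m' m => Complex.exp (α * Complex.I) ^ (-(m' : ℤ)) * (wignerSmall d m' m β : ℂ) *
    Complex.exp (γ * Complex.I) ^ (-(m : ℤ))

open Classical in
/-- The Wigner matrix `𝒟^d(k)`, `k ∈ SO(3, ℝ)`: write `k` in Euler angles with `0 ≤ β ≤ π`.
The result does not depend on the choice of the angles (see `wignerD_eulerRot`); matrices
outside `SO(3, ℝ)` are sent to `0`. -/
noncomputable def wignerD (d : ℕ) (k : Matrix (Fin 3) (Fin 3) ℝ) : Matrix (WIdx d) (WIdx d) ℂ :=
  if h : ∃ p : ℝ × ℝ × ℝ, 0 ≤ p.2.1 ∧ p.2.1 ≤ Real.pi ∧ k = eulerRot p.1 p.2.1 p.2.2 then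
    wignerEuler d h.choose.1 h.choose.2.1 h.choose.2.2
  else 0

theorem eulerRot_eq (α β γ : ℝ) : eulerRot α β γ =
    !![Real.cos α * Real.cos β * Real.cos γ - Real.sin α * Real.sin γ,
       -(Real.cos α * Real.cos β * Real.sin γ) - Real.sin α * Real.cos γ,
       Real.cos α * Real.sin β;
       Real.sin α * Real.cos β * Real.cos γ + Real.cos α * Real.sin γ,
       -(Real.sin α * Real.cos β * Real.sin γ) + Real.cos α * Real.cos γ,
       Real.sin α * Real.sin β;
       -(Real.sin β * Real.cos γ), Real.sin β * Real.sin γ, Real.cos β] := by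
  ext i j
  fin_cases i <;> fin_cases j <;>
    simp [eulerRot, rotZ, weylW3, Matrix.mul_apply, Fin.sum_univ_three] <;> ring

theorem wignerSmall_zero (d : ℕ) (m' m : WIdx d) (h : (m' : ℤ) ≠ m) :
    wignerSmall d m' m 0 = 0 := by
  obtain ⟨m', hm'⟩ := m'
  obtain ⟨m, hm⟩ := m
  simp only [Finset.mem_Icc] at hm hm' h
  unfold wignerSmall
  rw [Finset.sum_eq_zero, mul_zero]
  intro s hs
  simp only [Finset.mem_range] at hs
  by_cases h1 : (m - m' + 2 * s).toNat = 0
  · have : (d - m').toNat < (d - m - s).toNat ∨ (d + m').toNat < s := by omega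
    rcases this with h2 | h2 <;> rw [Nat.choose_eq_zero_of_lt h2] <;> simp
  · simp [h1]

theorem wignerSmall_pi (d : ℕ) (m' m : WIdx d) (h : (m' : ℤ) ≠ -m) :
    wignerSmall d m' m Real.pi = 0 := by
  obtain ⟨m', hm'⟩ := m'
  obtain ⟨m, hm⟩ := m
  simp only [Finset.mem_Icc] at hm hm' h
  unfold wignerSmall
  rw [Finset.sum_eq_zero, mul_zero]
  intro s hs
  simp only [Finset.mem_range] at hs
  by_cases h1 : (2 * d - m + m' - 2 * s).toNat = 0
  · have : (d + m').toNat < s := by omega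
    rw [Nat.choose_eq_zero_of_lt this]; simp
  · simp [h1]

theorem exp_mul_I_eq_of {a b : ℝ} (h1 : Real.cos a = Real.cos b) (h2 : Real.sin a = Real.sin b) :
    Complex.exp (a * Complex.I) = Complex.exp (b * Complex.I) := by
  rw [Complex.exp_mul_I, Complex.exp_mul_I, ← Complex.ofReal_cos, ← Complex.ofReal_cos,
    ← Complex.ofReal_sin, ← Complex.ofReal_sin, h1, h2]

theorem wignerEuler_congr (d : ℕ) {α β γ α' β' γ' : ℝ} (h0 : 0 ≤ β) (h1 : β ≤ Real.pi)
    (h0' : 0 ≤ β') (h1' : β' ≤ Real.pi) (h : eulerRot α β γ = eulerRot α' β' γ') :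
    wignerEuler d α β γ = wignerEuler d α' β' γ' := by
  have hβ : β = β' := by
    have := congrFun (congrFun h 2) 2
    simp only [eulerRot_eq] at this
    exact Real.injOn_cos ⟨h0, h1⟩ ⟨h0', h1'⟩ (by simpa using this)
  subst hβ
  rw [eulerRot_eq, eulerRot_eq] at h
  have e00 := congrFun (congrFun h 0) 0
  have e02 := congrFun (congrFun h 0) 2
  have e12 := congrFun (congrFun h 1) 2
  have e20 := congrFun (congrFun h 2) 0
  have e21 := congrFun (congrFun h 2) 1
  have e10 := congrFun (congrFun h 1) 0
  simp at e00 e02 e12 e20 e21 e10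
  ext m' m
  unfold wignerEuler
  by_cases hs : Real.sin β = 0
  · rcases h0.eq_or_lt with hb | hb
    · subst hb
      simp only [Real.cos_zero, mul_one] at e00 e10
      by_cases hm : (m' : ℤ) = m
      · have key : Complex.exp ((α + γ : ℝ) * Complex.I) =
            Complex.exp ((α' + γ' : ℝ) * Complex.I) :=
          exp_mul_I_eq_of (by rw [Real.cos_add, Real.cos_add, e00])
            (by rw [Real.sin_add, Real.sin_add, e10])
        push_cast at key
        rw [add_mul, add_mul, Complex.exp_add, Complex.exp_add] at key
        rw [hm, mul_right_comm, ← mul_zpow, key, mul_zpow, mul_right_comm]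
      · simp [wignerSmall_zero d m' m hm]
    · have hpi : β = Real.pi := by
        rcases h1.eq_or_lt with h' | h'
        · exact h'
        · exact absurd hs (Real.sin_pos_of_pos_of_lt_pi hb h').ne'
      subst hpi
      simp only [Real.cos_pi] at e00 e10
      by_cases hm : (m' : ℤ) = -m
      · have key : Complex.exp ((α - γ : ℝ) * Complex.I) =
            Complex.exp ((α' - γ' : ℝ) * Complex.I) :=
          exp_mul_I_eq_of (by rw [Real.cos_sub, Real.cos_sub]; linarith)
            (by rw [Real.sin_sub, Real.sin_sub]; linarith)
        push_cast at key
        rw [sub_mul, sub_mul, Complex.exp_sub, Complex.exp_sub] at key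
        rw [hm, neg_neg, mul_right_comm, _root_.zpow_neg, ← _root_.inv_zpow, ← mul_zpow, ← div_eq_mul_inv, key,
          div_eq_mul_inv, mul_zpow, mul_right_comm, _root_.inv_zpow, ← _root_.zpow_neg]
      · simp [wignerSmall_pi d m' m hm]
  · simp only [hs, or_false] at e02 e12
    rw [exp_mul_I_eq_of (a := α) (b := α') (by tauto) (by tauto),
      exp_mul_I_eq_of (a := γ) (b := γ') (by tauto) (by tauto)]

theorem wignerD_eulerRot (d : ℕ) {α β γ : ℝ} (h0 : 0 ≤ β) (h1 : β ≤ Real.pi) :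
    wignerD d (eulerRot α β γ) = wignerEuler d α β γ := by
  have h : ∃ p : ℝ × ℝ × ℝ, 0 ≤ p.2.1 ∧ p.2.1 ≤ Real.pi ∧
      eulerRot α β γ = eulerRot p.1 p.2.1 p.2.2 := ⟨(α, β, γ), h0, h1, rfl⟩
  rw [wignerD, dif_pos h]
  exact (wignerEuler_congr d h0 h1 h.choose_spec.1 h.choose_spec.2.1 h.choose_spec.2.2).symm

/-! ### Intertwining matrices -/

/-- The action `μ ↦ μ^w`, `p_{μ^w}(a) = p_μ(w a w⁻¹)`, of a Weyl element on the spectral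
parameters: for diagonal `a` the `i`-th diagonal entry of `w a w⁻¹` is `∑ⱼ wᵢⱼ² aⱼ`, and each row
of `w` has exactly one nonzero entry `±1`. -/
noncomputable def weylAct (w : Matrix (Fin 3) (Fin 3) ℝ) (μ : Fin 3 → ℂ) : Fin 3 → ℂ :=
  fun j => ∑ i, ((w i j ^ 2 : ℝ) : ℂ) * μ i

/-- The diagonal matrix `Γ^d_𝒲(u, ε)` with entries `Γ((1 - εm + u)/2) / Γ((1 - εm - u)/2)`, each
entry being taken as a meromorphic function of `u`: at a removable singularity its value is the
limit. -/
noncomputable def gammaW (d : ℕ) (u : ℂ) (ε : ℤ) : Matrix (WIdx d) (WIdx d) ℂ :=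
  Matrix.diagonal fun m =>
    toMeromorphicNFOn
      (fun z : ℂ => Complex.Gamma ((1 - ((ε * (m : ℤ) : ℤ) : ℂ) + z) / 2) /
        Complex.Gamma ((1 - ((ε * (m : ℤ) : ℤ) : ℂ) - z) / 2)) Set.univ u

/-- The intertwining matrix `T^d(w₂, μ)`. -/
noncomputable def intertwinerW2 (d : ℕ) (μ : Fin 3 → ℂ) : Matrix (WIdx d) (WIdx d) ℂ :=
  ((Real.pi : ℂ) ^ (μ 0 - μ 1)) • gammaW d (μ 1 - μ 0) 1

/-- The intertwining matrix `T^d(w₃, μ)`. -/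
noncomputable def intertwinerW3 (d : ℕ) (μ : Fin 3 → ℂ) : Matrix (WIdx d) (WIdx d) ℂ :=
  ((Real.pi : ℂ) ^ (μ 1 - μ 2)) •
    (wignerD d (vMinusMinus * weylWl) * gammaW d (μ 2 - μ 1) 1 * wignerD d (weylWl * vMinusMinus))

theorem weylW4_eq : weylW4 = weylW3 * weylW2 := by
  ext i j
  fin_cases i <;> fin_cases j <;>
    simp [weylW2, weylW3, weylW4, Matrix.mul_apply, Fin.sum_univ_three]

/-- The intertwining matrix `T^d(w₄, μ)`, from `w₄ = w₃ w₂` (see `weylW4_eq`) and the composition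
rule `T^d(w w', μ) = T^d(w, μ) T^d(w', μ^w)`. -/
noncomputable def intertwinerW4 (d : ℕ) (μ : Fin 3 → ℂ) : Matrix (WIdx d) (WIdx d) ℂ :=
  intertwinerW3 d μ * intertwinerW2 d (weylAct weylW3 μ)

/-! ### The vectors `u_j^{d,±}`, `g₂`, `g₃`, `g₄` -/

/-- The row vector `v^d_j`, with entry `1` at index `j` and `0` elsewhere. -/
def vVec (d : ℕ) (j : ℤ) : WIdx d → ℂ := fun m => if (m : ℤ) = j then 1 else 0

/-- The row vector `u^{d,ε}_j = (v^d_j + ε (-1)^d v^d_{-j}) / 2`. -/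
noncomputable def uVec (d : ℕ) (ε : ℤˣ) (j : ℤ) : WIdx d → ℂ :=
  (1 / 2 : ℂ) • (vVec d j + (((ε : ℤ) : ℂ) * (-1) ^ d) • vVec d (-j))

/-- The coefficient `g^d_{2,k,2j+k}`. -/
noncomputable def g2Coeff (d : ℕ) (μ : Fin 3 → ℂ) (k j : ℕ) : ℂ :=
  if k = 0 ∧ j = 0 then 1 / 2
  else (-1) ^ j * ∏ i ∈ Finset.range j,
    ((Real.sqrt (((d : ℝ) - 1 - 2 * i - k) * ((d : ℝ) - 2 * i - k)) : ℂ) *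
        (3 * μ 2 + 2 * d - 1 + 2 * i + k)) /
      ((Real.sqrt (((d : ℝ) + 1 + 2 * i + k) * ((d : ℝ) + 2 + 2 * i + k)) : ℂ) *
        (μ 0 - μ 1 - 1 - 2 * i - k))

/-- The coefficient `g^d_{3,δ,2j+δ}`, for `2j+δ ≤ d`. Below `d` it is `g^d_{2,δ,2j+δ}`; at
`2j+δ = d` it is `g^d_{2,δ,d-2} / √(d(2d-1))`, and twice that if `d = 2`, which makes up for
`g^d_{2,0,0} = 1/2`. -/
noncomputable def g3Coeff (d : ℕ) (μ : Fin 3 → ℂ) (δ j : ℕ) : ℂ :=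
  if 2 * j + δ < d then g2Coeff d μ δ j
  else (if d = 2 then 2 else 1) * g2Coeff d μ δ (j - 1) / (Real.sqrt (d * (2 * d - 1)) : ℂ)

/-- The vector `g₂^{d,δ,ε}`, for the parameters `μ`. -/
noncomputable def g2 (d : ℕ) (μ : Fin 3 → ℂ) (δ : ℕ) (ε : ℤˣ) : WIdx d → ℂ :=
  ∑ j ∈ (Finset.range (d + 1)).filter (fun j => 2 * j + δ ≤ d),
    g2Coeff d μ δ j • uVec d ε (2 * j + δ)

/-- The vector `g₃^{d,δ,ε}`, for the parameters `μ`. -/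
noncomputable def g3 (d : ℕ) (μ : Fin 3 → ℂ) (δ : ℕ) (ε : ℤˣ) : WIdx d → ℂ :=
  ∑ j ∈ (Finset.range (d + 1)).filter (fun j => 2 * j + δ ≤ d),
    g3Coeff d μ δ j • uVec d ε (2 * j + δ)

/-- The vector `g₄^{d,ε}`, for odd `d` and the parameters `μ`; here `κ = (d+1)/2`. -/
noncomputable def g4 (d : ℕ) (μ : Fin 3 → ℂ) (ε : ℤˣ) : WIdx d → ℂ :=
  ∑ j ∈ (Finset.range (d + 1)).filter (fun j => 2 * j + (d + 1) / 2 ≤ d),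
    g2Coeff d μ ((d + 1) / 2) j • uVec d ε (2 * j + ((d + 1) / 2 : ℕ))

/-! Both `vMinusMinus * weylWl` and `weylWl * vMinusMinus` are the rotation with Euler angles (0,
π/2, π). Its Wigner entries are, up to the weights √((d+m)!(d-m)!), coefficients of (X+1)^(d+m')
(X-1)^(d-m'). So the entries of u_j T(w₃), cleared of their weight, are (d+n)!(d-n)! times the
coefficients of ∑ ρ(a) (X+1)^a (X-1)^(2d-a). With m = a - d, ρ(a) is the Gamma factor at m, times 1
(row j = d) or m (row j = d-1), cut down to one parity of m and divided by a!(2d-a)!. Call the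
resulting function H the profile (`intertwinerProfile`).

The functional equation of Γ gives the Gamma factors a two-step recurrence in m. Since (X+1)^a
(X-1)^b behaves well under second order differential operators, the transform carries a recurrence
of this kind to another one (`krawtchoukTransform_two_step`). The result is (d+n-u) H(n) = (u-d+n+2)
H(n+2), where u is the argument of the Gamma matrix (`intertwinerProfile_add_two`). Once the weights
are restored, this is the ratio of consecutive coefficients of g₂. Together with the symmetry n ↦
-n, the vanishing on one parity class and H ≠ 0 (injectivity of the transform), it fixes the row up
to a nonzero scalar (`exists_sum_smul_uVec_eq`).

The cases differ in where the recurrence degenerates. For t = 0 and d odd one has u = κ - 1, and the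
factor u-d+n+2 vanishes at n = κ - 2. In the parity class of κ the profile is then supported on |n|
≥ κ, which gives g₄; the other class gives g₂ as before. For u = d - 1 both factors equal n + 1, so
H is constant on nonnegative indices of one parity. The last ratio in g₂ becomes 0/0 there, and g₃
contains the correct value. For T(w₄) such a constant profile is multiplied by the Gamma factors at
κ - 1, which vanish below κ in the class of κ and have the ratios of g₄. -/

/-! ### Krawtchouk numbers and their contiguity relations -/

open Polynomial in
/-- The coefficient of `X ^ n` in `(X + 1) ^ a * (X - 1) ^ b`, a Krawtchouk number. -/
noncomputable def krawtchouk (a b n : ℕ) : ℂ :=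
  ((X + 1) ^ a * (X - 1) ^ b : ℂ[X]).coeff n

open Polynomial in
theorem krawtchouk_succ (a b n : ℕ) : ((n : ℂ) + 1) * krawtchouk a b (n + 1) =
    a * krawtchouk (a - 1) b n + b * krawtchouk a (b - 1) n := by
  have h : derivative ((X + 1) ^ a * (X - 1) ^ b : ℂ[X]) =
      C (a : ℂ) * ((X + 1) ^ (a - 1) * (X - 1) ^ b) +
        C (b : ℂ) * ((X + 1) ^ a * (X - 1) ^ (b - 1)) := by
    simp [derivative_mul, derivative_pow]; ring
  have := congrArg (fun p => p.coeff n) h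
  simp only [coeff_derivative, coeff_add, coeff_C_mul] at this
  rw [krawtchouk, mul_comm, this]; rfl

open Polynomial in
theorem coeff_X_mul_derivative (p : ℂ[X]) (n : ℕ) : (X * derivative p).coeff n = n * p.coeff n := by
  cases n with
  | zero => simp
  | succ n => rw [coeff_X_mul, coeff_derivative]; push_cast; ring

open Polynomial in
theorem pow_pred_mul_self (p : ℂ[X]) (a : ℕ) : C (a : ℂ) * p ^ a = C (a : ℂ) * (p ^ (a - 1) * p) := by
  cases a <;> simp [pow_succ]

open Polynomial in
-- After homogenizing to (x+y)^a (x-y)^b this is the derivative in y, as `krawtchouk_succ` is the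
-- derivative in x.
theorem krawtchouk_degree_sub (a b n : ℕ) : ((a : ℂ) + b - n) * krawtchouk a b n =
    a * krawtchouk (a - 1) b n - b * krawtchouk a (b - 1) n := by
  have h : C ((a : ℂ) + b) * ((X + 1) ^ a * (X - 1) ^ b : ℂ[X]) -
      X * derivative ((X + 1) ^ a * (X - 1) ^ b : ℂ[X]) =
      C (a : ℂ) * ((X + 1) ^ (a - 1) * (X - 1) ^ b) -
        C (b : ℂ) * ((X + 1) ^ a * (X - 1) ^ (b - 1)) := by
    have h1 := pow_pred_mul_self (X + 1) a
    have h2 := pow_pred_mul_self (X - 1) b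
    simp only [derivative_mul, derivative_pow, C_add]
    simp only [derivative_add, derivative_sub, derivative_X, derivative_one]
    linear_combination (X - 1) ^ b * h1 + (X + 1) ^ a * h2
  have := congrArg (fun p => p.coeff n) h
  simp only [coeff_sub, coeff_C_mul, coeff_X_mul_derivative] at this
  rw [sub_mul]
  exact this

open Polynomial in
-- The operator 2X∂ - (a+b), applied to the product, trades one factor X+1 for X-1 or conversely.
theorem krawtchouk_weight (a b n : ℕ) : (2 * (n : ℂ) - a - b) * krawtchouk a b n =
    a * krawtchouk (a - 1) (b + 1) n + b * krawtchouk (a + 1) (b - 1) n := by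
  have h : 2 * (X * derivative ((X + 1) ^ a * (X - 1) ^ b : ℂ[X])) -
      C ((a : ℂ) + b) * ((X + 1) ^ a * (X - 1) ^ b : ℂ[X]) =
      C (a : ℂ) * ((X + 1) ^ (a - 1) * (X - 1) ^ (b + 1)) +
        C (b : ℂ) * ((X + 1) ^ (a + 1) * (X - 1) ^ (b - 1)) := by
    have h1 := pow_pred_mul_self (X + 1) a
    have h2 := pow_pred_mul_self (X - 1) b
    simp only [derivative_mul, derivative_pow, C_add]
    simp only [derivative_add, derivative_sub, derivative_X, derivative_one]
    linear_combination -(X - 1) ^ b * h1 - (X + 1) ^ a * h2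
  have := congrArg (fun p => p.coeff n) h
  simp only [← C_ofNat, coeff_sub, coeff_add, coeff_C_mul, coeff_X_mul_derivative] at this
  unfold krawtchouk
  linear_combination this

open Polynomial in
-- The operator x∂_y + y∂_x has (x+y)^a (x-y)^b as an eigenvector with eigenvalue a - b.
theorem krawtchouk_shift (a b n : ℕ) : ((a : ℂ) + b - n) * krawtchouk a b n +
    (n + 2) * krawtchouk a b (n + 2) = (a - b) * krawtchouk a b (n + 1) := by
  have h : X * (C ((a : ℂ) + b) * ((X + 1) ^ a * (X - 1) ^ b : ℂ[X]) -
      X * derivative ((X + 1) ^ a * (X - 1) ^ b : ℂ[X])) +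
      derivative ((X + 1) ^ a * (X - 1) ^ b : ℂ[X]) =
      C ((a : ℂ) - b) * ((X + 1) ^ a * (X - 1) ^ b) := by
    have h1 := pow_pred_mul_self (X + 1) a
    have h2 := pow_pred_mul_self (X - 1) b
    simp only [derivative_mul, derivative_pow, C_add, C_sub]
    simp only [derivative_add, derivative_sub, derivative_X, derivative_one]
    linear_combination (X - 1) ^ (b + 1) * h1 + (X + 1) ^ (a + 1) * h2
  have := congrArg (fun p => p.coeff (n + 1)) h
  simp only [coeff_X_mul, coeff_sub, coeff_add, coeff_C_mul, coeff_X_mul_derivative,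
    coeff_derivative] at this
  unfold krawtchouk
  push_cast at this
  linear_combination this

/-- The second order operator whose kernel gives the two-step recurrence, applied to a product of
powers. -/
theorem krawtchouk_two_step (a b n : ℕ) (u : ℂ) :
    (n - u) * ((a + b - n) * (a + b - n - 1)) * krawtchouk a b n +
      (a + b - 2 - n - u) * ((n + 2) * (n + 1)) * krawtchouk a b (n + 2) =
    a * (a - 1) * (a - 2 - b - 2 * u) * krawtchouk (a - 2) b n -
      b * (b - 1) * (a - b + 2 + 2 * u) * krawtchouk a (b - 2) n := by
  have cast_pred (c : ℕ) (z : ℂ) : (c : ℂ) * (((c - 1 : ℕ) : ℂ) * z) = c * (c - 1) * z := by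
    cases c <;> simp; ring
  have d1 := krawtchouk_succ a b (n + 1)
  have d2 := krawtchouk_succ (a - 1) b n
  have d3 := krawtchouk_succ a (b - 1) n
  have e1 := krawtchouk_degree_sub a b n
  -- The second derivatives in x and in y, `s1` and `s2` below, contain the mixed term K(a-1, b-1)
  -- with opposite signs. In the weighted combination its coefficient is a multiple of 2n+2-a-b, so
  -- the weight operator expresses it by the two pure terms.
  have key : (b : ℂ) * (a * (a - 1) * krawtchouk (a - 2) b n) +
      a * (b * (b - 1) * krawtchouk a (b - 2) n) =
      (2 * n + 2 - a - b) * (a * b * krawtchouk (a - 1) (b - 1) n) := by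
    rcases a with _ | a
    · simp
    rcases b with _ | b
    · simp
    have := krawtchouk_weight a b n
    simp only [Nat.add_sub_cancel, Nat.reduceSubDiff]
    push_cast
    linear_combination (-(a + 1) * (b + 1) : ℂ) * this
  have s1 : ((n : ℂ) + 2) * (n + 1) * krawtchouk a b (n + 2) =
      a * (a - 1) * krawtchouk (a - 2) b n + 2 * (a * b * krawtchouk (a - 1) (b - 1) n) +
        b * (b - 1) * krawtchouk a (b - 2) n := by
    have c1 := cast_pred a (krawtchouk (a - 2) b n)
    have c2 := cast_pred b (krawtchouk a (b - 2) n)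
    simp only [Nat.sub_sub, Nat.reduceAdd] at d2 d3
    push_cast at d1
    linear_combination (n + 1) * d1 + a * d2 + b * d3 + c1 + c2
  have s2 : ((a : ℂ) + b - n) * (a + b - n - 1) * krawtchouk a b n =
      a * (a - 1) * krawtchouk (a - 2) b n - 2 * (a * b * krawtchouk (a - 1) (b - 1) n) +
        b * (b - 1) * krawtchouk a (b - 2) n := by
    have c1 := cast_pred a (krawtchouk (a - 2) b n)
    have c2 := cast_pred b (krawtchouk a (b - 2) n)
    have f1 : (a : ℂ) * ((a + b - n - 1) * krawtchouk (a - 1) b n) = a * ((a - 1 : ℕ) *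
        krawtchouk (a - 2) b n - b * krawtchouk (a - 1) (b - 1) n) := by
      rcases a with _ | a
      · simp
      have := krawtchouk_degree_sub a b n
      simp only [Nat.add_sub_cancel, Nat.reduceSubDiff]
      push_cast
      linear_combination (a + 1 : ℂ) * this
    have f2 : (b : ℂ) * ((a + b - n - 1) * krawtchouk a (b - 1) n) = b * (a *
        krawtchouk (a - 1) (b - 1) n - (b - 1 : ℕ) * krawtchouk a (b - 2) n) := by
      rcases b with _ | b
      · simp
      have := krawtchouk_degree_sub a b n
      simp only [Nat.add_sub_cancel, Nat.reduceSubDiff]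
      push_cast
      linear_combination (b + 1 : ℂ) * this
    linear_combination (a + b - n - 1) * e1 + f1 - f2 + c1 + c2
  linear_combination (n - u) * s2 + (a + b - 2 - n - u) * s1 + 2 * key

open Polynomial in
-- Substitute -X for X.
theorem krawtchouk_swap (a b n : ℕ) :
    krawtchouk b a n = (-1) ^ (a + b + n) * krawtchouk a b n := by
  have h : ((X + 1) ^ b * (X - 1) ^ a : ℂ[X]) =
      C ((-1 : ℂ) ^ (a + b)) * ((X + 1) ^ a * (X - 1) ^ b : ℂ[X]).comp (C (-1) * X) := by
    simp only [mul_comp, pow_comp, add_comp, sub_comp, X_comp, one_comp, C_pow, C_neg, C_1]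
    have e1 : (-1 * X + 1 : ℂ[X]) = -1 * (X - 1) := by ring
    have e2 : (-1 * X - 1 : ℂ[X]) = -1 * (X + 1) := by ring
    rw [e1, e2, mul_pow, mul_pow]
    have : ((-1 : ℂ[X]) ^ (a + b)) * ((-1) ^ a * (-1) ^ b) = 1 := by
      rw [← pow_add, ← pow_add, ← two_mul, pow_mul]; simp
    linear_combination -((X + 1) ^ b * (X - 1) ^ a : ℂ[X]) * this
  rw [krawtchouk, h, coeff_C_mul, comp_C_mul_X_coeff, krawtchouk, pow_add]
  ring

open Polynomial in
theorem natDegree_X_add_C_pow_le (c : ℂ) (a : ℕ) : ((X + C c : ℂ[X]) ^ a).natDegree ≤ a :=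
  (natDegree_pow_le_of_le a (natDegree_X_add_C c).le).trans (by simp)

open Polynomial in
theorem reflect_X_add_C_pow (c : ℂ) (a : ℕ) :
    reflect a ((X + C c : ℂ[X]) ^ a) = (1 + C c * X) ^ a := by
  have h1 : reflect 1 (X + C c : ℂ[X]) = 1 + C c * X := by
    rw [reflect_add, reflect_C]
    simp
  induction a with
  | zero => simp
  | succ a ih =>
    rw [pow_succ, reflect_mul _ _ (natDegree_X_add_C_pow_le c a) (natDegree_X_add_C c).le, ih, h1,
      pow_succ]

open Polynomial in
-- Reversing the coefficients fixes X + 1 and changes the sign of X - 1.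
theorem krawtchouk_reflect {a b n m : ℕ} (h : n + m = a + b) :
    krawtchouk a b m = (-1) ^ b * krawtchouk a b n := by
  have e : ((X + 1) ^ a * (X - 1) ^ b : ℂ[X]) = (X + C 1) ^ a * (X + C (-1)) ^ b := by
    simp [sub_eq_add_neg]
  have h1 : reflect (a + b) ((X + 1) ^ a * (X - 1) ^ b : ℂ[X]) =
      C ((-1) ^ b) * ((X + 1) ^ a * (X - 1) ^ b) := by
    rw [e, reflect_mul _ _ (natDegree_X_add_C_pow_le _ a) (natDegree_X_add_C_pow_le _ b),
      reflect_X_add_C_pow, reflect_X_add_C_pow, C_pow, mul_left_comm, ← mul_pow]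
    simp only [map_one, map_neg]
    congr 2 <;> ring
  have := congrArg (fun p => p.coeff n) h1
  simp only [coeff_reflect, coeff_C_mul] at this
  rw [revAt_le (by omega), show a + b - n = m by omega] at this
  exact this

open Polynomial in
theorem krawtchouk_zero_right (a n : ℕ) : krawtchouk a 0 n = a.choose n := by
  simp [krawtchouk, coeff_X_add_one_pow]

open Polynomial in
theorem krawtchouk_eq_sum (a b n : ℕ) : krawtchouk a b n =
    (-1) ^ b * ∑ s ∈ Finset.range (n + 1), (-1) ^ s * (a.choose (n - s) : ℂ) * (b.choose s : ℂ) := by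
  have h : ((X + 1) ^ a * (X - 1) ^ b : ℂ[X]) =
      C ((-1 : ℂ) ^ b) * (((X + 1) ^ b).comp (C (-1) * X) * (X + 1) ^ a) := by
    simp only [pow_comp, add_comp, X_comp, one_comp, C_pow, C_neg, C_1]
    have e1 : (-1 * X + 1 : ℂ[X]) = -1 * (X - 1) := by ring
    rw [e1, mul_pow]
    have : ((-1 : ℂ[X]) ^ b) * (-1) ^ b = 1 := by
      rw [← pow_add, ← two_mul, pow_mul]; simp
    linear_combination -((X + 1) ^ a * (X - 1) ^ b : ℂ[X]) * this
  rw [krawtchouk, h, coeff_C_mul, coeff_mul, Finset.Nat.sum_antidiagonal_eq_sum_range_succ_mk]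
  congr 1
  refine Finset.sum_congr rfl fun s _ => ?_
  rw [comp_C_mul_X_coeff, coeff_X_add_one_pow, coeff_X_add_one_pow]
  ring

/-! ### The Krawtchouk transform of a sequence -/

/-- The coefficients of `∑ a, ρ a * (X + 1) ^ a * (X - 1) ^ (N - a)`. -/
noncomputable def krawtchoukTransform (N : ℕ) (ρ : ℕ → ℂ) (n : ℕ) : ℂ :=
  ∑ p ∈ Finset.HasAntidiagonal.antidiagonal N, ρ p.1 * krawtchouk p.1 p.2 n

theorem sum_antidiagonal_mul_pred (N : ℕ) (f : ℕ → ℕ → ℂ) :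
    ∑ p ∈ Finset.HasAntidiagonal.antidiagonal (N + 2), (p.1 : ℂ) * (p.1 - 1) * f p.1 p.2 =
      ∑ p ∈ Finset.HasAntidiagonal.antidiagonal N, ((p.1 : ℂ) + 2) * (p.1 + 1) * f (p.1 + 2) p.2 := by
  rw [Finset.Nat.sum_antidiagonal_succ, Finset.Nat.sum_antidiagonal_succ]
  simp only [Nat.cast_zero, Nat.cast_add, Nat.cast_one]
  simp only [zero_mul, zero_add, sub_self, mul_zero]
  refine Finset.sum_congr rfl fun p _ => ?_
  ring

/-- By `krawtchouk_two_step` the left side is a sum of terms K(a-2, b) and K(a, b-2). Shifting the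
summation index turns both into sums over a + b = N of K(a, b), and the hypothesis on ρ says that
they cancel term by term. -/
theorem krawtchoukTransform_two_step {N : ℕ} {ρ : ℕ → ℂ} {u : ℂ}
    (hρ : ∀ a b : ℕ, a + b = N → ((a : ℂ) - b - 2 * u) * ((a + 2) * (a + 1)) * ρ (a + 2) =
      (a - b + 2 * u) * ((b + 2) * (b + 1)) * ρ a)
    {n m : ℕ} (h : n + m = N) :
    ((n : ℂ) - u) * ((m + 2) * (m + 1)) * krawtchoukTransform (N + 2) ρ n +
      (m - u) * ((n + 2) * (n + 1)) * krawtchoukTransform (N + 2) ρ (n + 2) = 0 := by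
  unfold krawtchoukTransform
  rw [Finset.mul_sum, Finset.mul_sum, ← Finset.sum_add_distrib]
  have step : ∀ p ∈ Finset.HasAntidiagonal.antidiagonal (N + 2),
      ((n : ℂ) - u) * ((m + 2) * (m + 1)) * (ρ p.1 * krawtchouk p.1 p.2 n) +
      (m - u) * ((n + 2) * (n + 1)) * (ρ p.1 * krawtchouk p.1 p.2 (n + 2)) =
      (p.1 : ℂ) * (p.1 - 1) * ((p.1 - 2 - p.2 - 2 * u) * ρ p.1 * krawtchouk (p.1 - 2) p.2 n) -
      (p.2 : ℂ) * (p.2 - 1) * ((p.1 - p.2 + 2 + 2 * u) * ρ p.1 * krawtchouk p.1 (p.2 - 2) n) := by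
    intro p hp
    have hs : (p.1 : ℂ) + p.2 = n + m + 2 := by
      rw [Finset.HasAntidiagonal.mem_antidiagonal] at hp
      exact_mod_cast (by omega : p.1 + p.2 = n + m + 2)
    have := krawtchouk_two_step p.1 p.2 n u
    rw [show (p.1 : ℂ) + p.2 - n = m + 2 by linear_combination hs,
      show (p.1 : ℂ) + p.2 - 2 - n - u = m - u by linear_combination hs] at this
    linear_combination ρ p.1 * this
  rw [Finset.sum_congr rfl step, Finset.sum_sub_distrib]
  -- `sum_antidiagonal_mul_pred` shifts the first coordinate only, so the terms with b(b-1) are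
  -- swapped before the shift and swapped back afterwards.
  have hswap := Finset.Nat.sum_antidiagonal_swap (n := N + 2) (f := fun p => (p.1 : ℂ) * (p.1 - 1) *
    ((p.2 - p.1 + 2 + 2 * u) * ρ p.2 * krawtchouk p.2 (p.1 - 2) n))
  simp only [Prod.fst_swap, Prod.snd_swap] at hswap
  have hswap' := Finset.Nat.sum_antidiagonal_swap (n := N) (f := fun p => ((p.2 : ℂ) + 2) * (p.2 + 1) *
    ((p.1 - p.2 + 2 * u) * ρ p.1 * krawtchouk p.1 p.2 n))
  simp only [Prod.fst_swap, Prod.snd_swap] at hswap'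
  rw [hswap, sum_antidiagonal_mul_pred N
    (fun a b => ((a : ℂ) - 2 - b - 2 * u) * ρ a * krawtchouk (a - 2) b n),
    sum_antidiagonal_mul_pred N
    (fun a b => ((b : ℂ) - a + 2 + 2 * u) * ρ b * krawtchouk b (a - 2) n), sub_eq_zero]
  refine Eq.trans ?_ (Eq.trans hswap'.symm ?_)
  · refine Finset.sum_congr rfl fun p hp => ?_
    have := hρ p.1 p.2 (Finset.HasAntidiagonal.mem_antidiagonal.mp hp)
    simp only [Nat.add_sub_cancel]
    push_cast
    linear_combination krawtchouk p.1 p.2 n * this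
  · refine Finset.sum_congr rfl fun p _ => ?_
    simp only [Nat.add_sub_cancel]
    push_cast
    ring

theorem krawtchoukTransform_shift (N : ℕ) (ρ : ℕ → ℂ) (n : ℕ) :
    krawtchoukTransform N (fun a => (2 * a - N) * ρ a) (n + 1) =
      (N - n) * krawtchoukTransform N ρ n + (n + 2) * krawtchoukTransform N ρ (n + 2) := by
  unfold krawtchoukTransform
  rw [Finset.mul_sum, Finset.mul_sum, ← Finset.sum_add_distrib]
  refine Finset.sum_congr rfl fun p hp => ?_
  have hs : (p.1 : ℂ) + p.2 = N := by
    exact_mod_cast Finset.HasAntidiagonal.mem_antidiagonal.mp hp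
  have := krawtchouk_shift p.1 p.2 n
  rw [← hs]
  linear_combination -ρ p.1 * this

theorem krawtchoukTransform_reflect {N : ℕ} {ρ : ℕ → ℂ} {s : ℂ}
    (hρ : ∀ a b, a + b = N → (-1) ^ b * ρ a = s * ρ a) {n m : ℕ} (h : n + m = N) :
    krawtchoukTransform N ρ m = s * krawtchoukTransform N ρ n := by
  unfold krawtchoukTransform
  rw [Finset.mul_sum]
  refine Finset.sum_congr rfl fun p hp => ?_
  have hp := Finset.HasAntidiagonal.mem_antidiagonal.mp hp
  rw [krawtchouk_reflect (h.trans hp.symm)]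
  linear_combination krawtchouk p.1 p.2 n * hρ p.1 p.2 hp

theorem krawtchoukTransform_parity {N : ℕ} {ρ : ℕ → ℂ} {σ : ℂ}
    (hρ : ∀ a b, a + b = N → ρ b = σ * ρ a) (n : ℕ) :
    krawtchoukTransform N ρ n = σ * (-1) ^ (N + n) * krawtchoukTransform N ρ n := by
  conv_lhs => rw [krawtchoukTransform, ← Finset.Nat.sum_antidiagonal_swap]
  rw [krawtchoukTransform, Finset.mul_sum]
  refine Finset.sum_congr rfl fun p hp => ?_
  have hp := Finset.HasAntidiagonal.mem_antidiagonal.mp hp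
  rw [Prod.fst_swap, Prod.snd_swap, hρ p.1 p.2 hp, krawtchouk_swap, hp]
  ring

open Polynomial in
-- The transform is injective because X = (t+1)/(t-1) turns (X+1)^a (X-1)^(N-a) into (2/(t-1))^N
-- t^a. If all coefficients vanish, then ∑ ρ(a) t^a vanishes for every t ≠ 1.
theorem exists_krawtchoukTransform_ne_zero {N : ℕ} {ρ : ℕ → ℂ} (hρ : ∃ a ≤ N, ρ a ≠ 0) :
    ∃ n ≤ N, krawtchoukTransform N ρ n ≠ 0 := by
  by_contra! hcon
  obtain ⟨a₀, ha₀, hne⟩ := hρ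
  set Q : ℂ[X] := ∑ p ∈ Finset.HasAntidiagonal.antidiagonal N, C (ρ p.1) * ((X + 1) ^ p.1 * (X - 1) ^ p.2) with hQ
  have hdeg : Q.natDegree ≤ N := by
    refine natDegree_sum_le_of_forall_le _ _ fun p hp => ?_
    have hp := Finset.HasAntidiagonal.mem_antidiagonal.mp hp
    refine (natDegree_C_mul_le _ _).trans (natDegree_mul_le.trans ?_)
    have h1 := natDegree_X_add_C_pow_le 1 p.1
    have h2 := natDegree_X_add_C_pow_le (-1) p.2
    simp only [map_one, map_neg, ← sub_eq_add_neg] at h1 h2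
    omega
  have hQ0 : Q = 0 := by
    ext n
    by_cases hn : n ≤ N
    · have := hcon n hn
      rw [hQ, finsetSum_coeff, coeff_zero, ← this]
      exact Finset.sum_congr rfl fun p _ => coeff_C_mul _
    · rw [coeff_zero, coeff_eq_zero_of_natDegree_lt (by omega)]
  set P : ℂ[X] := ∑ p ∈ Finset.HasAntidiagonal.antidiagonal N, C (ρ p.1) * X ^ p.1 with hP
  have hP0 : P = 0 := by
    refine eq_zero_of_infinite_isRoot P (Set.Infinite.mono (s := {1}ᶜ) ?_
      (Set.finite_singleton (1 : ℂ)).infinite_compl)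
    intro t ht
    have ht' : t - 1 ≠ 0 := sub_ne_zero.mpr ht
    have h := congrArg (eval ((t + 1) / (t - 1))) hQ0
    rw [hQ, eval_finsetSum, eval_zero] at h
    have : (2 / (t - 1)) ^ N * eval t P = 0 := by
      rw [← h, hP, eval_finsetSum, Finset.mul_sum]
      refine Finset.sum_congr rfl fun p hp => ?_
      have hp := Finset.HasAntidiagonal.mem_antidiagonal.mp hp
      simp only [eval_mul, eval_C, eval_pow, eval_X, eval_add, eval_sub, eval_one]
      rw [show (t + 1) / (t - 1) + 1 = t * (2 / (t - 1)) by field_simp; ring,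
        show (t + 1) / (t - 1) - 1 = 2 / (t - 1) by field_simp; ring, ← hp, pow_add, mul_pow]
      ring
    rcases mul_eq_zero.mp this with h0 | h0
    · exact absurd h0 (pow_ne_zero _ (div_ne_zero two_ne_zero ht'))
    · exact h0
  have := congrArg (fun p => p.coeff a₀) hP0
  simp only [hP, finsetSum_coeff, coeff_C_mul, coeff_X_pow, coeff_zero] at this
  rw [Finset.sum_eq_single (a₀, N - a₀)] at this
  · simp at this; exact hne this
  · intro p hp hpne
    have hp := Finset.HasAntidiagonal.mem_antidiagonal.mp hp
    rw [if_neg, mul_zero]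
    rintro rfl
    exact hpne (Prod.ext rfl (by simp; omega))
  · intro h0
    exact absurd (Finset.HasAntidiagonal.mem_antidiagonal.mpr (by simp; omega)) h0

/-! ### The Gamma factors: reflection, recurrence, zeros -/

/-- The diagonal entry of `gammaW d u 1` at index `m`. -/
noncomputable def gammaEntry (u : ℂ) (m : ℤ) : ℂ :=
  toMeromorphicNFOn
    (fun z : ℂ => Complex.Gamma ((1 - ((1 * m : ℤ) : ℂ) + z) / 2) /
      Complex.Gamma ((1 - ((1 * m : ℤ) : ℂ) - z) / 2)) Set.univ u

/-- The quotient `Γ((1 - m + z) / 2) / Γ((1 - m - z) / 2)`. -/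
noncomputable def gammaQuot (m : ℤ) (z : ℂ) : ℂ :=
  Complex.Gamma ((1 - m + z) / 2) * (Complex.Gamma ((1 - m - z) / 2))⁻¹

/-- The conventions Γ(-n) = 0 and 0⁻¹ = 0 give 1/Γ its true value at the poles, so no exception is
needed. -/
theorem analyticAt_Gamma_inv (s : ℂ) : AnalyticAt ℂ (fun s : ℂ => (Complex.Gamma s)⁻¹) s :=
  Complex.differentiable_one_div_Gamma.analyticAt s

theorem meromorphicAt_gammaQuot (m : ℤ) (u : ℂ) : MeromorphicAt (gammaQuot m) u := by
  refine MeromorphicAt.mul ?_ ?_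
  · have h : (fun z : ℂ => Complex.Gamma ((1 - m + z) / 2)) =
        (fun z : ℂ => (Complex.Gamma ((1 - m + z) / 2))⁻¹)⁻¹ := by ext; simp
    rw [h]
    exact ((analyticAt_Gamma_inv _).fun_comp (f := fun z : ℂ => (1 - m + z) / 2)
      (by fun_prop)).meromorphicAt.inv
  · exact ((analyticAt_Gamma_inv _).fun_comp (f := fun z : ℂ => (1 - m - z) / 2)
      (by fun_prop)).meromorphicAt

/-- The normal form is local, so an entry depends only on the germ of the quotient at u. -/
theorem gammaEntry_eq (u : ℂ) (m : ℤ) : gammaEntry u m = toMeromorphicNFAt (gammaQuot m) u u := by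
  have h : (fun z : ℂ => Complex.Gamma ((1 - ((1 * m : ℤ) : ℂ) + z) / 2) /
      Complex.Gamma ((1 - ((1 * m : ℤ) : ℂ) - z) / 2)) = gammaQuot m := by
    ext z; rw [gammaQuot, one_mul, div_eq_mul_inv]
  rw [gammaEntry, h, toMeromorphicNFOn_eq_toMeromorphicNFAt
    (fun z _ => meromorphicAt_gammaQuot m z) (Set.mem_univ u)]

theorem analyticAt_gammaQuot {m : ℤ} {u : ℂ} (h : 0 < (1 - m + u).re) :
    AnalyticAt ℂ (gammaQuot m) u := by
  refine AnalyticAt.mul ?_ ?_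
  · have hG : AnalyticAt ℂ Complex.Gamma ((1 - m + u) / 2) := by
      have := (analyticAt_Gamma_inv ((1 - m + u) / 2)).inv (inv_ne_zero
        (Complex.Gamma_ne_zero_of_re_pos (by simpa using h)))
      rwa [show (fun s : ℂ => (Complex.Gamma s)⁻¹)⁻¹ = Complex.Gamma by ext; simp] at this
    exact hG.fun_comp (f := fun z : ℂ => (1 - m + z) / 2) (by fun_prop)
  · exact (analyticAt_Gamma_inv _).fun_comp (f := fun z : ℂ => (1 - m - z) / 2) (by fun_prop)

theorem gammaEntry_of_re_pos {m : ℤ} {u : ℂ} (h : 0 < (1 - m + u).re) :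
    gammaEntry u m = gammaQuot m u := by
  rw [gammaEntry_eq, toMeromorphicNFAt_eq_self.mpr (analyticAt_gammaQuot h).meromorphicNFAt]

theorem eventually_ne_int (u : ℂ) : ∀ᶠ z : ℂ in nhdsWithin u {u}ᶜ, ∀ n : ℤ, z ≠ (n : ℂ) := by
  have hc : IsClosed (((↑) : ℤ → ℂ) '' {n : ℤ | (n : ℂ) ≠ u}) :=
    Complex.isClosedEmbedding_intCast.isClosedMap _ (isClosed_discrete _)
  have hu : u ∈ (((↑) : ℤ → ℂ) '' {n : ℤ | (n : ℂ) ≠ u})ᶜ := by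
    rintro ⟨n, hn, rfl⟩; exact hn rfl
  filter_upwards [mem_nhdsWithin_of_mem_nhds (hc.isOpen_compl.mem_nhds hu), self_mem_nhdsWithin]
    with z hz hzu n hn
  exact hz ⟨n, fun h => hzu (hn.trans h), hn.symm⟩

/-- Apply Γ(s)Γ(1-s) = π/sin(πs) at s = (1-m±z)/2; the two sines differ by (-1)^m. Away from the
integers no Gamma argument is a pole. -/
theorem gammaQuot_neg_of_ne_int (m : ℤ) {z : ℂ} (hz : ∀ n : ℤ, z ≠ n) :
    gammaQuot m z = (-1) ^ m * gammaQuot (-m) z := by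
  have hG (n : ℤ) (s : ℂ) (hs : s = (n + z) / 2 ∨ s = (n - z) / 2) : ∀ k : ℕ, s ≠ -k := by
    intro k hk
    rcases hs with hs | hs
    · refine hz (-2 * k - n) ?_
      push_cast
      linear_combination 2 * hk - 2 * hs
    · refine hz (2 * k + n) ?_
      push_cast
      linear_combination -2 * hk + 2 * hs
  have r1 := Complex.Gamma_mul_Gamma_one_sub ((1 - m + z) / 2)
  have r2 := Complex.Gamma_mul_Gamma_one_sub ((1 - m - z) / 2)
  have n1 := Complex.Gamma_ne_zero (hG (1 - m) ((1 - m + z) / 2) (Or.inl (by push_cast; ring)))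
  have n2 := Complex.Gamma_ne_zero (hG (1 - m) ((1 - m - z) / 2) (Or.inr (by push_cast; ring)))
  have n3 := Complex.Gamma_ne_zero (hG (1 + m) ((1 + m + z) / 2) (Or.inl (by push_cast; ring)))
  have n4 := Complex.Gamma_ne_zero (hG (1 + m) ((1 + m - z) / 2) (Or.inr (by push_cast; ring)))
  rw [show (1 : ℂ) - (1 - m + z) / 2 = (1 + m - z) / 2 by ring] at r1
  rw [show (1 : ℂ) - (1 - m - z) / 2 = (1 + m + z) / 2 by ring] at r2
  have hsin : Complex.sin (Real.pi * ((1 - m + z) / 2)) =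
      (-1) ^ m * Complex.sin (Real.pi * ((1 - m - z) / 2)) := by
    rw [show (Real.pi * ((1 - m + z) / 2) : ℂ) =
      Real.pi - Real.pi * ((1 - m - z) / 2) - m * Real.pi by ring,
      Complex.sin_antiperiodic.sub_int_mul_eq, Complex.sin_pi_sub, Int.cast_negOnePow]
  have hpi : (Real.pi : ℂ) ≠ 0 := by exact_mod_cast Real.pi_ne_zero
  have hs1 : Complex.sin (Real.pi * ((1 - m + z) / 2)) ≠ 0 := by
    intro h0; rw [h0, div_zero] at r1; exact mul_ne_zero n1 n4 r1
  have hs2 : Complex.sin (Real.pi * ((1 - m - z) / 2)) ≠ 0 := by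
    intro h0; rw [h0, div_zero] at r2; exact mul_ne_zero n2 n3 r2
  rw [eq_div_iff hs1] at r1
  rw [eq_div_iff hs2] at r2
  have hm : ((-1 : ℂ) ^ m) * (-1) ^ m = 1 := by
    rw [← mul_zpow]; simp
  rw [gammaQuot, gammaQuot, Int.cast_neg, sub_neg_eq_add]
  rw [hsin] at r1
  rw [← div_eq_mul_inv, ← div_eq_mul_inv, ← mul_div_assoc, div_eq_div_iff n2 n4]
  refine mul_right_cancel₀ (mul_ne_zero (zpow_ne_zero m (by norm_num : (-1 : ℂ) ≠ 0)) hs2) ?_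
  linear_combination r1 - r2 - Complex.Gamma ((1 + m + z) / 2) * Complex.Gamma ((1 - m - z) / 2) *
    Complex.sin (Real.pi * ((1 - m - z) / 2)) * hm

/-- The reflection holds on a punctured neighbourhood of u, hence for normal forms at u. For m ≤ 0
and Re u > 0 the quotient is analytic at u and is its own normal form; positive indices are reached
only through this lemma. -/
theorem gammaEntry_neg {u : ℂ} (hu : 0 < u.re) (m : ℤ) :
    gammaEntry u (-m) = (-1) ^ m * gammaEntry u m := by
  have key (m : ℤ) (hm : m ≤ 0) : gammaEntry u (-m) = (-1) ^ m * gammaEntry u m := by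
    have hre : 0 < (1 - m + u).re := by
      have : (m : ℝ) ≤ 0 := by exact_mod_cast hm
      simp; linarith
    have hev : gammaQuot (-m) =ᶠ[nhdsWithin u {u}ᶜ] fun z => (-1) ^ m * gammaQuot m z := by
      filter_upwards [eventually_ne_int u] with z hz
      rw [gammaQuot_neg_of_ne_int (-m) hz, neg_neg, _root_.zpow_neg, ← _root_.inv_zpow, inv_neg, inv_one]
    have han : AnalyticAt ℂ (fun z => (-1) ^ m * gammaQuot m z) u :=
      analyticAt_const.mul (analyticAt_gammaQuot hre)
    rw [gammaEntry_eq, (toMeromorphicNFAt_eventuallyEq_nhds_congr hev).eq_of_nhds,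
      toMeromorphicNFAt_eq_self.mpr han.meromorphicNFAt, gammaEntry_of_re_pos hre]
  rcases le_total m 0 with hm | hm
  · exact key m hm
  · have := key (-m) (by omega)
    rw [neg_neg] at this
    rw [this, ← mul_assoc, ← zpow_add₀ (by norm_num)]
    simp

theorem gammaEntry_add_two {u : ℂ} (hu : 0 < u.re) (m : ℤ) :
    ((m : ℂ) + 1 - u) * gammaEntry u (m + 2) = (m + 1 + u) * gammaEntry u m := by
  have key (m : ℤ) (hm : m + 2 ≤ 0) :
      ((m : ℂ) + 1 - u) * gammaEntry u (m + 2) = (m + 1 + u) * gammaEntry u m := by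
    have hm' : (m : ℝ) + 2 ≤ 0 := by exact_mod_cast hm
    rw [gammaEntry_of_re_pos (by simp; linarith), gammaEntry_of_re_pos (by simp; linarith),
      gammaQuot, gammaQuot]
    have h0 : (1 - ((m + 2 : ℤ) : ℂ) + u) / 2 ≠ 0 := by
      intro h
      have := congrArg Complex.re h
      simp at this
      linarith
    have h1 := Complex.Gamma_add_one _ h0
    have h2 := Complex.one_div_Gamma_eq_self_mul_one_div_Gamma_add_one
      ((1 - ((m + 2 : ℤ) : ℂ) - u) / 2)
    rw [show (1 - ((m + 2 : ℤ) : ℂ) + u) / 2 + 1 = (1 - m + u) / 2 by push_cast; ring] at h1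
    rw [show (1 - ((m + 2 : ℤ) : ℂ) - u) / 2 + 1 = (1 - m - u) / 2 by push_cast; ring] at h2
    rw [h1, h2]
    push_cast
    ring
  -- For m < -1 the functional equation applies directly. The step from -1 to 1 is the reflection
  -- itself, and m > -1 reflects to the step from -m-2 to -m.
  rcases lt_trichotomy m (-1) with hm | hm | hm
  · exact key m (by omega)
  · subst hm
    have := gammaEntry_neg hu (-1)
    norm_num at this ⊢
    rw [this]; ring
  · have := key (-m - 2) (by omega)
    rw [show -m - 2 + 2 = -m by ring, show -m - 2 = -(m + 2) by ring, gammaEntry_neg hu,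
      gammaEntry_neg hu, zpow_add₀ (by norm_num)] at this
    have hm0 : ((-1 : ℂ) ^ m) ≠ 0 := zpow_ne_zero _ (by norm_num)
    refine mul_left_cancel₀ hm0 ?_
    push_cast at this
    norm_num at this
    linear_combination this

theorem gammaEntry_ne_zero {u : ℂ} (hu : 0 < u.re) {m : ℤ} (hm : m ≤ 0) (h : u.re < 1 - m) :
    gammaEntry u m ≠ 0 := by
  have hm' : (m : ℝ) ≤ 0 := by exact_mod_cast hm
  rw [gammaEntry_of_re_pos (by simp; linarith), gammaQuot]
  refine mul_ne_zero (Complex.Gamma_ne_zero_of_re_pos ?_)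
    (inv_ne_zero (Complex.Gamma_ne_zero_of_re_pos ?_))
  · simp; linarith
  · simp; linarith

theorem gammaEntry_eq_zero {u : ℕ} (hu : 0 < u) {m : ℤ} (hm : |m| < u + 1)
    (hpar : Even (m + u + 1)) : gammaEntry u m = 0 := by
  have hu' : 0 < (u : ℂ).re := by simpa using hu
  have key (m : ℤ) (hm0 : m ≤ 0) (hm : |m| < u + 1) (hpar : Even (m + u + 1)) :
      gammaEntry u m = 0 := by
    have hm' : (m : ℝ) ≤ 0 := by exact_mod_cast hm0
    have hu'' : (0 : ℝ) < u := by exact_mod_cast hu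
    obtain ⟨k, hk⟩ := hpar
    have hkm : (1 - (m : ℂ) - u) / 2 = -((k - 1 : ℤ) : ℂ) := by
      have : (m : ℂ) + u + 1 = k + k := by exact_mod_cast hk
      push_cast
      linear_combination -this / 2
    rw [gammaEntry_of_re_pos (by simp; linarith), gammaQuot, hkm,
      show (k - 1 : ℤ) = ((k - 1).toNat : ℤ) by
        rw [abs_of_nonpos hm0] at hm; omega]
    -- The denominator sits at a pole of Γ, so its inverse is 0, while the numerator is finite
    -- because m ≤ 0 < u.
    rw [Int.cast_natCast, Complex.Gamma_neg_nat_eq_zero]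
    simp
  rcases le_total m 0 with h0 | h0
  · exact key m h0 hm hpar
  · have := key (-m) (by omega) (by rwa [abs_neg])
      (by rw [show -m + u + 1 = (m + u + 1) - 2 * m by ring]; exact hpar.sub (even_two_mul m))
    rw [gammaEntry_neg hu'] at this
    exact (mul_eq_zero.mp this).resolve_left (zpow_ne_zero _ (by norm_num))

/-! ### The Wigner matrix of the rotation by π/2 -/

/-- The weight `√((d + m)! (d - m)!)`. -/
noncomputable def wignerWeight (d : ℕ) (m : ℤ) : ℝ :=
  Real.sqrt (((d + m).toNat.factorial * (d - m).toNat.factorial : ℕ) : ℝ)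

theorem wignerWeight_pos (d : ℕ) (m : ℤ) : 0 < wignerWeight d m :=
  Real.sqrt_pos.mpr (by exact_mod_cast Nat.mul_pos (Nat.factorial_pos _) (Nat.factorial_pos _))

theorem wignerWeight_ne_zero (d : ℕ) (m : ℤ) : (wignerWeight d m : ℂ) ≠ 0 := by
  exact_mod_cast (wignerWeight_pos d m).ne'

theorem wignerWeight_neg (d : ℕ) (m : ℤ) : wignerWeight d (-m) = wignerWeight d m := by
  rw [wignerWeight, wignerWeight, sub_neg_eq_add, ← sub_eq_add_neg, mul_comm]

theorem wignerWeight_mul_self (d : ℕ) (m : ℤ) : (wignerWeight d m : ℂ) * wignerWeight d m =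
    (d + m).toNat.factorial * (d - m).toNat.factorial := by
  rw [← Complex.ofReal_mul, wignerWeight, Real.mul_self_sqrt (by positivity)]
  push_cast; rfl

/-- The entries of the Wigner matrix of the rotation exchanging the first and third axes. -/
noncomputable def wignerFlip (d : ℕ) (m' m : ℤ) : ℂ :=
  (-1 / 2) ^ d * (wignerWeight d m / wignerWeight d m') *
    krawtchouk (d + m').toNat (d - m').toNat (d + m).toNat

theorem wignerSmall_pi_div_two (d : ℕ) (m' m : WIdx d) :
    (wignerSmall d m' m (Real.pi / 2) : ℂ) = (-1) ^ (m : ℤ) * wignerFlip d m' m := by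
  obtain ⟨m', hm'⟩ := m'
  obtain ⟨m, hm⟩ := m
  simp only [Finset.mem_Icc] at hm hm'
  obtain ⟨p, hp⟩ := Int.eq_ofNat_of_zero_le (by omega : 0 ≤ d + m')
  obtain ⟨q, hq⟩ := Int.eq_ofNat_of_zero_le (by omega : 0 ≤ d - m')
  obtain ⟨r, hr⟩ := Int.eq_ofNat_of_zero_le (by omega : 0 ≤ d + m)
  obtain ⟨n, hn⟩ := Int.eq_ofNat_of_zero_le (by omega : 0 ≤ d - m)
  -- At β = π/2 the sine and cosine of β/2 are equal and their exponents add up to 2d, so only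
  -- 2^(-d) and an alternating binomial sum remain.
  have hsum : ∑ s ∈ Finset.range ((d - m).toNat + 1),
      (-1 : ℝ) ^ s * ((d - m').toNat.choose (d - m - s).toNat : ℝ) * ((d + m').toNat.choose s : ℝ) *
        Real.sin (Real.pi / 2 / 2) ^ (m - m' + 2 * s).toNat *
        Real.cos (Real.pi / 2 / 2) ^ (2 * d - m + m' - 2 * s).toNat =
      (1 / 2) ^ d * ∑ s ∈ Finset.range (n + 1),
        (-1 : ℝ) ^ s * (q.choose (n - s) : ℝ) * (p.choose s : ℝ) := by
    rw [hn, hp, hq, Finset.mul_sum]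
    refine Finset.sum_congr rfl fun s hs => ?_
    have hs := Finset.mem_range.mp hs
    rw [show ((n : ℤ) - s).toNat = n - s by omega, Int.toNat_natCast, Int.toNat_natCast]
    rcases lt_or_ge q (n - s) with h | h
    · simp [Nat.choose_eq_zero_of_lt h]
    rcases lt_or_ge p s with h' | h'
    · simp [Nat.choose_eq_zero_of_lt h']
    rw [show Real.pi / 2 / 2 = Real.pi / 4 by ring, Real.sin_pi_div_four, Real.cos_pi_div_four,
      mul_assoc, ← pow_add, show (m - m' + 2 * (s : ℤ)).toNat +
      (2 * (d : ℤ) - m + m' - 2 * s).toNat = 2 * d by omega, pow_mul, div_pow,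
      Real.sq_sqrt (by norm_num)]
    ring
  have hw : Real.sqrt ((((d + m).toNat.factorial * (d - m).toNat.factorial : ℕ) : ℝ) /
      (((d + m').toNat.factorial * (d - m').toNat.factorial : ℕ) : ℝ)) =
      wignerWeight d m / wignerWeight d m' := by
    rw [Real.sqrt_div (by positivity)]; rfl
  have hK := krawtchouk_eq_sum q p n
  rw [krawtchouk_swap p q n, krawtchouk_reflect (a := p) (b := q) (n := r) (m := n) (by omega)] at hK
  have h1 (k : ℕ) : ((-1 : ℂ) ^ k) * (-1) ^ k = 1 := by rw [← mul_pow]; simp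
  have hS : ∑ s ∈ Finset.range (n + 1), (-1) ^ s * (q.choose (n - s) : ℂ) * (p.choose s : ℂ) =
      (-1) ^ n * krawtchouk p q r := by
    refine mul_left_cancel₀ (pow_ne_zero p (by norm_num : (-1 : ℂ) ≠ 0)) ?_
    rw [← hK, pow_add, pow_add]
    linear_combination (-1) ^ p * (-1) ^ n * krawtchouk p q r * h1 q
  rw [wignerSmall, hsum, hw]
  push_cast
  rw [hS, wignerFlip]
  rw [hp, hq, hr, Int.toNat_natCast, Int.toNat_natCast, Int.toNat_natCast]
  have h4 : ((-1 : ℂ) ^ m) = (-1) ^ r * (-1) ^ d := by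
    rw [show m = (r : ℤ) - d by omega, zpow_sub₀ (by norm_num), zpow_natCast, zpow_natCast,
      div_eq_iff (pow_ne_zero _ (by norm_num)), mul_assoc, h1, mul_one]
  have h2 : ((-1 : ℂ) ^ n) = (-1) ^ r := by
    have : ((-1 : ℂ) ^ n) * (-1) ^ r = 1 := by
      rw [← pow_add, show n + r = 2 * d by omega, pow_mul]; simp
    linear_combination (-1) ^ r * this - (-1) ^ n * h1 r
  have h3 : (-1 / 2 : ℂ) ^ d = (-1) ^ d * (1 / 2) ^ d := by rw [← mul_pow]; norm_num
  rw [h2, h3, h4]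
  linear_combination -((wignerWeight d m : ℂ) / wignerWeight d m') * (1 / 2) ^ d * (-1) ^ r *
    krawtchouk p q r * h1 d

theorem vMinusMinus_mul_weylWl : vMinusMinus * weylWl = eulerRot 0 (Real.pi / 2) Real.pi := by
  rw [eulerRot_eq]
  ext i j
  fin_cases i <;> fin_cases j <;> simp [vMinusMinus, weylWl, Matrix.mul_apply, Fin.sum_univ_three]

theorem weylWl_mul_vMinusMinus : weylWl * vMinusMinus = eulerRot 0 (Real.pi / 2) Real.pi := by
  rw [eulerRot_eq]
  ext i j
  fin_cases i <;> fin_cases j <;> simp [vMinusMinus, weylWl, Matrix.mul_apply, Fin.sum_univ_three]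

/-- The third Euler angle π contributes (-1)^m, which cancels the sign in `wignerSmall_pi_div_two`.
-/
theorem wignerD_eulerRot_flip (d : ℕ) (m' m : WIdx d) :
    wignerD d (eulerRot 0 (Real.pi / 2) Real.pi) m' m = wignerFlip d m' m := by
  rw [wignerD_eulerRot d (by positivity) (by linarith [Real.pi_pos]), wignerEuler,
    wignerSmall_pi_div_two]
  have h : ((-1 : ℂ) ^ (m : ℤ)) * (-1) ^ (-(m : ℤ)) = 1 := by
    rw [← zpow_add₀ (by norm_num)]; simp
  rw [Complex.exp_pi_mul_I]
  simp only [Complex.ofReal_zero, zero_mul, Complex.exp_zero, _root_.one_zpow, one_mul]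
  linear_combination wignerFlip d m' m * h

theorem wignerFlip_neg_left (d : ℕ) {m' m : ℤ} (hm' : |m'| ≤ d) (hm : |m| ≤ d) :
    wignerFlip d (-m') m = (-1) ^ d * (-1) ^ m * wignerFlip d m' m := by
  rw [abs_le] at hm hm'
  rw [wignerFlip, wignerFlip, wignerWeight_neg, sub_neg_eq_add, ← sub_eq_add_neg, krawtchouk_swap]
  have : ((-1 : ℂ) ^ ((d + m').toNat + (d - m').toNat + (d + m).toNat)) = (-1) ^ d * (-1) ^ m := by
    rw [← zpow_natCast, ← zpow_natCast, ← zpow_add₀ (by norm_num),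
      show (((d + m').toNat + (d - m').toNat + (d + m).toNat : ℕ) : ℤ) = 2 * d + (d + m) by omega,
      zpow_add₀ (by norm_num), _root_.zpow_mul]
    simp
  rw [this]
  ring

theorem wignerFlip_top (d : ℕ) {m : ℤ} (hm : |m| ≤ d) : wignerFlip d d m =
    (-1 / 2) ^ d * wignerWeight d d / wignerWeight d m := by
  rw [abs_le] at hm
  have h1 := wignerWeight_mul_self d m
  have h2 := wignerWeight_mul_self d d
  have h3 := Nat.choose_mul_factorial_mul_factorial (show (d + m).toNat ≤ 2 * d by omega)
  rw [show 2 * d - (d + m).toNat = (d - m).toNat by omega] at h3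
  rw [sub_self, Int.toNat_zero, Nat.factorial_zero, Nat.cast_one, mul_one,
    show ((d : ℤ) + d).toNat = 2 * d by omega] at h2
  rw [wignerFlip, sub_self, Int.toNat_zero, krawtchouk_zero_right,
    show ((d : ℤ) + d).toNat = 2 * d by omega]
  have n1 := wignerWeight_ne_zero d m
  have n2 := wignerWeight_ne_zero d d
  field_simp
  rw [pow_two, pow_two, h1, h2, ← h3]
  push_cast
  ring

/-- The weight operator applied to (X+1)^(2d) shows that row d-1 is row d times m, up to a constant.
-/
theorem wignerFlip_top_sub_one {d : ℕ} (hd : 1 ≤ d) {m : ℤ} (hm : |m| ≤ d) :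
    wignerFlip d (d - 1) m = (-1 / 2) ^ d * (wignerWeight d d ^ 2 / wignerWeight d (d - 1) / d) *
      m / wignerWeight d m := by
  rw [abs_le] at hm
  have h1 := wignerWeight_mul_self d m
  have h2 := wignerWeight_mul_self d d
  have h3 := Nat.choose_mul_factorial_mul_factorial (show (d + m).toNat ≤ 2 * d by omega)
  rw [show 2 * d - (d + m).toNat = (d - m).toNat by omega] at h3
  rw [sub_self, Int.toNat_zero, Nat.factorial_zero, Nat.cast_one, mul_one,
    show ((d : ℤ) + d).toNat = 2 * d by omega] at h2
  have h4 := krawtchouk_weight (2 * d) 0 (d + m).toNat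
  have hcast : (((d + m).toNat : ℕ) : ℂ) = d + m := by
    exact_mod_cast congrArg (Int.cast : ℤ → ℂ) (Int.toNat_of_nonneg (by omega : 0 ≤ d + m))
  rw [krawtchouk_zero_right, hcast] at h4
  push_cast at h4
  rw [wignerFlip, show ((d : ℤ) - (d - 1)).toNat = 1 by omega,
    show ((d : ℤ) + (d - 1)).toNat = 2 * d - 1 by omega]
  have n1 := wignerWeight_ne_zero d m
  have n2 := wignerWeight_ne_zero d (d - 1)
  have n3 : (d : ℂ) ≠ 0 := by exact_mod_cast (by omega : d ≠ 0)
  have h5 : (d : ℂ) * krawtchouk (2 * d - 1) 1 (d + m).toNat = m * (2 * d).choose (d + m).toNat := by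
    linear_combination -h4 / 2
  field_simp
  rw [pow_two, pow_two, h1, h2, ← h3]
  push_cast
  linear_combination ((d + m).toNat.factorial * (d - m).toNat.factorial : ℂ) * h5

theorem sum_wIdx (d : ℕ) (f : ℤ → ℂ) :
    ∑ m : WIdx d, f m = ∑ p ∈ Finset.HasAntidiagonal.antidiagonal (2 * d), f ((p.1 : ℤ) - d) := by
  rw [Finset.sum_coe_sort (Finset.Icc (-(d : ℤ)) d) f]
  refine Finset.sum_nbij' (fun m => ((d + m).toNat, (d - m).toNat)) (fun p => (p.1 : ℤ) - d)
    ?_ ?_ ?_ ?_ ?_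
  · intro m hm
    rw [Finset.mem_Icc] at hm
    rw [Finset.HasAntidiagonal.mem_antidiagonal]
    dsimp only
    omega
  · intro p hp
    rw [Finset.HasAntidiagonal.mem_antidiagonal] at hp
    rw [Finset.mem_Icc]
    omega
  · intro m hm
    rw [Finset.mem_Icc] at hm
    dsimp only
    omega
  · intro p hp
    rw [Finset.HasAntidiagonal.mem_antidiagonal] at hp
    ext <;> dsimp only <;> omega
  · intro m hm
    rw [Finset.mem_Icc] at hm
    congr 1
    dsimp only
    omega

/-! ### The profile of u_j T(w₃) -/

/-- The coefficient at index `a - d` of the middle row vector, in the monomial normalization. -/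
noncomputable def profileCoeff (d : ℕ) (u : ℂ) (ε : ℤˣ) (q : ℤ → ℂ) (a : ℕ) : ℂ :=
  (1 + ((ε : ℤ) : ℂ) * (-1) ^ ((a : ℤ) - d)) * q ((a : ℤ) - d) * gammaEntry u ((a : ℤ) - d) /
    (a.factorial * (2 * d - a).factorial)

/-- The entries of `u_j^{d,ε} 𝒟 Γ 𝒟`, up to a constant and the weight; here `q m` is proportional
to the product of the entry `(j, m)` of `𝒟` and the weight of `m`. -/
noncomputable def intertwinerProfile (d : ℕ) (u : ℂ) (ε : ℤˣ) (q : ℤ → ℂ) (n : ℤ) : ℂ :=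
  (d + n).toNat.factorial * (d - n).toNat.factorial *
    krawtchoukTransform (2 * d) (profileCoeff d u ε q) (d + n).toNat

theorem uVec_vecMul_apply (d : ℕ) (ε : ℤˣ) {j : ℤ} (hj : |j| ≤ d)
    (A : Matrix (WIdx d) (WIdx d) ℂ) (f : ℤ → ℤ → ℂ) (hA : ∀ m' m : WIdx d, A m' m = f m' m)
    (m : WIdx d) : (uVec d ε j ᵥ* A) m =
      1 / 2 * (f j m + ((ε : ℤ) : ℂ) * (-1) ^ d * f (-j) m) := by
  rw [abs_le] at hj
  have hv (j : ℤ) (h1 : -(d : ℤ) ≤ j) (h2 : j ≤ d) : (vVec d j ᵥ* A) m = f j m := by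
    rw [vecMul, dotProduct, Finset.sum_eq_single ⟨j, Finset.mem_Icc.mpr ⟨h1, h2⟩⟩]
    · simp [vVec, hA]
    · intro b _ hb
      have : (b : ℤ) ≠ j := fun h => hb (Subtype.ext h)
      simp [vVec, this]
    · simp
  rw [uVec, smul_vecMul, add_vecMul, smul_vecMul]
  simp only [Pi.smul_apply, Pi.add_apply, smul_eq_mul]
  rw [hv j hj.1 hj.2, hv (-j) (by omega) (by omega)]

/-- Rows j and -j of the first Wigner matrix differ by (-1)^d (-1)^m, so u_j yields row j times the
parity projector (1 + ε(-1)^m)/2. The two factors 1/√((d+m)!(d-m)!), one from each Wigner matrix,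
combine to the denominator of `profileCoeff`. -/
theorem exists_uVec_vecMul_intertwinerW3 (d : ℕ) (ν : Fin 3 → ℂ) (ε : ℤˣ) {j : ℤ} (hj : |j| ≤ d)
    {q : ℤ → ℂ} {c : ℂ} (hc : c ≠ 0)
    (hq : ∀ m : ℤ, |m| ≤ d → wignerFlip d j m = c * q m / wignerWeight d m) :
    ∃ C : ℂ, C ≠ 0 ∧ ∀ n : WIdx d, (uVec d ε j ᵥ* intertwinerW3 d ν) n =
      C * intertwinerProfile d (ν 2 - ν 1) ε q n / wignerWeight d n := by
  have hpi : ((Real.pi : ℂ) ^ (ν 1 - ν 2)) ≠ 0 := by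
    rw [Ne, Complex.cpow_eq_zero_iff]
    simp [Real.pi_ne_zero]
  refine ⟨(Real.pi : ℂ) ^ (ν 1 - ν 2) * (1 / 2 * c * (-1 / 2) ^ d),
    mul_ne_zero hpi (mul_ne_zero (mul_ne_zero (by norm_num) hc) (pow_ne_zero _ (by norm_num))), ?_⟩
  intro n
  have hn := n.2
  rw [Finset.mem_Icc] at hn
  rw [intertwinerW3, vMinusMinus_mul_weylWl, weylWl_mul_vMinusMinus, vecMul_smul, ← vecMul_vecMul,
    ← vecMul_vecMul, Pi.smul_apply, smul_eq_mul, vecMul, dotProduct]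
  have hterm : ∀ m : WIdx d, ((uVec d ε j ᵥ* wignerD d (eulerRot 0 (Real.pi / 2) Real.pi)) ᵥ*
      gammaW d (ν 2 - ν 1) 1) m * wignerD d (eulerRot 0 (Real.pi / 2) Real.pi) m n =
      1 / 2 * ((1 + ((ε : ℤ) : ℂ) * (-1) ^ (m : ℤ)) * (c * q m / wignerWeight d m)) *
        gammaEntry (ν 2 - ν 1) m * wignerFlip d m n := by
    intro m
    have hm := m.2
    rw [Finset.mem_Icc] at hm
    rw [gammaW, vecMul_diagonal, uVec_vecMul_apply d ε hj _ _ (wignerD_eulerRot_flip d),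
      wignerFlip_neg_left d hj (abs_le.mpr hm), hq m (abs_le.mpr hm), wignerD_eulerRot_flip]
    have h1 : ((-1 : ℂ) ^ d) * (-1) ^ d = 1 := by rw [← mul_pow]; simp
    change _ * gammaEntry (ν 2 - ν 1) m * _ = _
    linear_combination 1 / 2 * ((ε : ℤ) : ℂ) * (-1) ^ (m : ℤ) * (c * q m / wignerWeight d m) *
        gammaEntry (ν 2 - ν 1) m * wignerFlip d m n * h1
  rw [Finset.sum_congr rfl fun m _ => hterm m, sum_wIdx d fun m =>
      1 / 2 * ((1 + ((ε : ℤ) : ℂ) * (-1) ^ m) * (c * q m / wignerWeight d m)) *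
        gammaEntry (ν 2 - ν 1) m * wignerFlip d m n, intertwinerProfile, krawtchoukTransform,
    ← wignerWeight_mul_self]
  have hwn := wignerWeight_ne_zero d n
  rw [eq_div_iff hwn, Finset.mul_sum, Finset.mul_sum, Finset.mul_sum, Finset.sum_mul]
  refine Finset.sum_congr rfl fun p hp => ?_
  rw [Finset.HasAntidiagonal.mem_antidiagonal] at hp
  have hwp := wignerWeight_ne_zero d ((p.1 : ℤ) - d)
  have hw2 := wignerWeight_mul_self d ((p.1 : ℤ) - d)
  have hf1 : (p.1.factorial : ℂ) ≠ 0 := by exact_mod_cast Nat.factorial_ne_zero _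
  have hf2 : (p.2.factorial : ℂ) ≠ 0 := by exact_mod_cast Nat.factorial_ne_zero _
  rw [wignerFlip, profileCoeff, show (d + ((p.1 : ℤ) - d)).toNat = p.1 by omega,
    show (d - ((p.1 : ℤ) - d)).toNat = p.2 by omega, show 2 * d - p.1 = p.2 by omega]
  rw [show (d + ((p.1 : ℤ) - d)).toNat = p.1 by omega,
    show (d - ((p.1 : ℤ) - d)).toNat = p.2 by omega] at hw2
  rw [← hw2]
  field_simp

theorem coe_units_eq_or (ε : ℤˣ) (m : ℤ) :
    ((ε : ℤ) : ℂ) = (-1) ^ m ∨ 1 + ((ε : ℤ) : ℂ) * (-1) ^ m = 0 := by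
  rcases Int.units_eq_one_or ε with rfl | rfl <;> rcases Int.even_or_odd m with h | h <;>
    simp [h.neg_one_zpow]

theorem one_add_coe_units_mul_mul (ε : ℤˣ) (m : ℤ) (z : ℂ) :
    (1 + ((ε : ℤ) : ℂ) * (-1) ^ m) * ((-1) ^ m * z) =
      ((ε : ℤ) : ℂ) * ((1 + ((ε : ℤ) : ℂ) * (-1) ^ m) * z) := by
  rcases Int.units_eq_one_or ε with rfl | rfl <;> rcases Int.even_or_odd m with h | h <;>
    simp [h.neg_one_zpow]

/-- The factorials in `profileCoeff` absorb the quadratic factors in the hypothesis of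
`krawtchoukTransform_two_step`. The recurrence is needed only for m with (-1)^m = ε, since the
projector kills the others. -/
theorem intertwinerProfile_add_two {d : ℕ} {u : ℂ} {ε : ℤˣ} {q : ℤ → ℂ}
    (hq : ∀ m : ℤ, -(d : ℤ) ≤ m → m + 2 ≤ d → ((ε : ℤ) : ℂ) = (-1) ^ m →
      ((m : ℂ) + 1 - u) * (q (m + 2) * gammaEntry u (m + 2)) =
        (m + 1 + u) * (q m * gammaEntry u m))
    {n : ℤ} (h1 : -(d : ℤ) ≤ n) (h2 : n + 2 ≤ d) :
    (d + n - u) * intertwinerProfile d u ε q n =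
      (u - d + n + 2) * intertwinerProfile d u ε q (n + 2) := by
  obtain ⟨N, hN⟩ : ∃ N, 2 * d = N + 2 := ⟨2 * d - 2, by omega⟩
  obtain ⟨k, hk⟩ := Int.eq_ofNat_of_zero_le (by omega : 0 ≤ d + n)
  obtain ⟨l, hl⟩ := Int.eq_ofNat_of_zero_le (by omega : 0 ≤ d - (n + 2))
  have hρ : ∀ a b : ℕ, a + b = N →
      ((a : ℂ) - b - 2 * u) * ((a + 2) * (a + 1)) * profileCoeff d u ε q (a + 2) =
        (a - b + 2 * u) * ((b + 2) * (b + 1)) * profileCoeff d u ε q a := by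
    intro a b hab
    have e1 : ((a + 2 : ℕ) : ℤ) - d = ((a : ℤ) - d) + 2 := by push_cast; ring
    rw [profileCoeff, profileCoeff, e1, show 2 * d - (a + 2) = b by omega,
      show 2 * d - a = b + 2 by omega, zpow_add₀ (by norm_num)]
    have hm := hq ((a : ℤ) - d) (by omega) (by omega)
    generalize hmm : (a : ℤ) - d = m at hm ⊢
    have hab' : (a : ℂ) - b = 2 * m + 2 := by
      have : (a : ℤ) - b = 2 * m + 2 := by omega
      exact_mod_cast congrArg (Int.cast : ℤ → ℂ) this
    have ha : (a.factorial : ℂ) ≠ 0 := by exact_mod_cast Nat.factorial_ne_zero _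
    have hb : (b.factorial : ℂ) ≠ 0 := by exact_mod_cast Nat.factorial_ne_zero _
    have ha1 : (a : ℂ) + 1 ≠ 0 := by exact_mod_cast Nat.succ_ne_zero a
    have ha2 : (a : ℂ) + 1 + 1 ≠ 0 := by exact_mod_cast Nat.succ_ne_zero (a + 1)
    have hb1 : (b : ℂ) + 1 ≠ 0 := by exact_mod_cast Nat.succ_ne_zero b
    have hb2 : (b : ℂ) + 1 + 1 ≠ 0 := by exact_mod_cast Nat.succ_ne_zero (b + 1)
    rw [hab']
    simp only [Nat.factorial_succ]
    push_cast
    rcases coe_units_eq_or ε m with h | h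
    · have := hm h
      norm_num
      field_simp
      ring_nf at this ⊢
      linear_combination (1 + ((ε : ℤ) : ℂ) * (-1) ^ m) * (a + 2) * (b + 2) * this
    · norm_num [h]
  have key := krawtchoukTransform_two_step hρ (n := k) (m := l) (by omega)
  rw [← hN] at key
  rw [intertwinerProfile, intertwinerProfile, show (d + n).toNat = k by omega,
    show (d - n).toNat = l + 2 by omega, show (d + (n + 2)).toNat = k + 2 by omega,
    show (d - (n + 2)).toNat = l by omega]
  have hk' : (k : ℂ) = d + n := by exact_mod_cast (congrArg (Int.cast : ℤ → ℂ) hk).symm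
  have hl' : (l : ℂ) = d - (n + 2) := by exact_mod_cast (congrArg (Int.cast : ℤ → ℂ) hl).symm
  rw [← hk', show u - d + n + 2 = u - l by rw [hl']; ring]
  simp only [Nat.factorial_succ]
  push_cast
  linear_combination (k.factorial : ℂ) * l.factorial * key

theorem intertwinerProfile_neg {d : ℕ} (u : ℂ) (ε : ℤˣ) (q : ℤ → ℂ) {n : ℤ} (hn : |n| ≤ d) :
    intertwinerProfile d u ε q (-n) = ((ε : ℤ) : ℂ) * (-1) ^ d * intertwinerProfile d u ε q n := by
  rw [abs_le] at hn
  have hρ : ∀ a b : ℕ, a + b = 2 * d → (-1) ^ b * profileCoeff d u ε q a =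
      (((ε : ℤ) : ℂ) * (-1) ^ d) * profileCoeff d u ε q a := by
    intro a b hab
    have e1 : ((-1 : ℂ) ^ b) = (-1) ^ d * (-1) ^ ((a : ℤ) - d) := by
      have h2 : ((-1 : ℂ) ^ (2 * ((a : ℤ) - d))) = 1 := by rw [_root_.zpow_mul]; simp
      rw [← zpow_natCast, ← zpow_natCast, ← zpow_add₀ (by norm_num),
        show (d : ℤ) + (a - d) = b + 2 * ((a : ℤ) - d) by omega, zpow_add₀ (by norm_num), h2,
        mul_one]
    have := one_add_coe_units_mul_mul ε ((a : ℤ) - d) 1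
    rw [profileCoeff, e1]
    linear_combination (-1) ^ d * (q ((a : ℤ) - d) * gammaEntry u ((a : ℤ) - d) /
      (a.factorial * (2 * d - a).factorial)) * this
  rw [intertwinerProfile, intertwinerProfile, sub_neg_eq_add, ← sub_eq_add_neg,
    krawtchoukTransform_reflect hρ (n := (d + n).toNat) (m := (d - n).toNat) (by omega)]
  ring

/-- Symmetry of ρ under a ↔ 2d - a makes the generating polynomial even or odd. The identity forces
zero wherever the sign is -1. -/
theorem intertwinerProfile_parity {d : ℕ} {u : ℂ} (hu : 0 < u.re) {ε : ℤˣ} {q : ℤ → ℂ} {τ : ℂ}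
    (hq : ∀ m, q (-m) = τ * q m) {n : ℤ} (hn : |n| ≤ d) : intertwinerProfile d u ε q n =
      ((ε : ℤ) : ℂ) * τ * (-1) ^ d * (-1) ^ n * intertwinerProfile d u ε q n := by
  rw [abs_le] at hn
  have hρ : ∀ a b : ℕ, a + b = 2 * d → profileCoeff d u ε q b =
      (((ε : ℤ) : ℂ) * τ) * profileCoeff d u ε q a := by
    intro a b hab
    rw [profileCoeff, profileCoeff, show (b : ℤ) - d = -((a : ℤ) - d) by omega, hq,
      gammaEntry_neg hu, show 2 * d - b = a by omega, show 2 * d - a = b by omega,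
      _root_.zpow_neg, ← _root_.inv_zpow, inv_neg, inv_one]
    have := one_add_coe_units_mul_mul ε ((a : ℤ) - d) 1
    linear_combination τ * (q ((a : ℤ) - d) * gammaEntry u ((a : ℤ) - d) /
      (a.factorial * b.factorial)) * this
  have := krawtchoukTransform_parity hρ (d + n).toNat
  have e : ((-1 : ℂ) ^ (2 * d + (d + n).toNat)) = (-1) ^ d * (-1) ^ n := by
    rw [pow_add, pow_mul, ← zpow_natCast _ (d + n).toNat, Int.toNat_of_nonneg (by omega),
      zpow_add₀ (by norm_num)]
    simp
  rw [e] at this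
  conv_lhs => rw [intertwinerProfile, this]
  rw [intertwinerProfile]
  ring

theorem exists_intertwinerProfile_ne_zero {d : ℕ} {u : ℂ} {ε : ℤˣ} {q : ℤ → ℂ}
    (h : ∃ m : ℤ, |m| ≤ d ∧ ((ε : ℤ) : ℂ) = (-1) ^ m ∧ q m * gammaEntry u m ≠ 0) :
    ∃ n : ℤ, |n| ≤ d ∧ intertwinerProfile d u ε q n ≠ 0 := by
  obtain ⟨m, hm, hε, hne⟩ := h
  rw [abs_le] at hm
  have hf (k : ℕ) : (k.factorial : ℂ) ≠ 0 := by exact_mod_cast Nat.factorial_ne_zero _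
  obtain ⟨k, hk, hne'⟩ := exists_krawtchoukTransform_ne_zero (N := 2 * d)
    (ρ := profileCoeff d u ε q) ⟨(d + m).toNat, by omega, by
      rw [profileCoeff, show ((d + m).toNat : ℤ) - d = m by omega, mul_assoc, hε,
        ← mul_zpow]
      refine div_ne_zero (mul_ne_zero ?_ hne) (mul_ne_zero (hf _) (hf _))
      norm_num⟩
  refine ⟨(k : ℤ) - d, abs_le.mpr (by omega), ?_⟩
  rw [intertwinerProfile, show (d + ((k : ℤ) - d)).toNat = k by omega]
  exact mul_ne_zero (mul_ne_zero (hf _) (hf _)) hne'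

/-- Passing from q = 1 to q(m) = m multiplies ρ(a) by a - d, half the eigenvalue in
`krawtchouk_shift`. Row d-1 is thereby computed from row d. -/
theorem intertwinerProfile_id {d : ℕ} {u : ℂ} {ε : ℤˣ} {n : ℤ} (hn : |n| < d) :
    2 * intertwinerProfile d u ε (fun m => m) n =
      (d + n) * intertwinerProfile d u ε (fun _ => 1) (n - 1) +
        (d - n) * intertwinerProfile d u ε (fun _ => 1) (n + 1) := by
  rw [abs_lt] at hn
  obtain ⟨k, hk⟩ := Int.eq_ofNat_of_zero_le (by omega : 0 ≤ d + n - 1)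
  obtain ⟨l, hl⟩ := Int.eq_ofNat_of_zero_le (by omega : 0 ≤ d - n - 1)
  have key := krawtchoukTransform_shift (2 * d) (profileCoeff d u ε fun _ => 1) k
  have hρ : (fun a : ℕ => (2 * (a : ℂ) - (2 * d : ℕ)) * profileCoeff d u ε (fun _ => 1) a) =
      fun a => 2 * profileCoeff d u ε (fun m => m) a := by
    ext a
    rw [profileCoeff, profileCoeff]
    push_cast
    ring
  have h2 : krawtchoukTransform (2 * d) (fun a => 2 * profileCoeff d u ε (fun m => m) a) (k + 1) =
      2 * krawtchoukTransform (2 * d) (profileCoeff d u ε (fun m => m)) (k + 1) := by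
    simp only [krawtchoukTransform, Finset.mul_sum, mul_assoc]
  rw [hρ, h2] at key
  have hk' : (d : ℂ) + n = k + 1 := by
    have := congrArg (Int.cast : ℤ → ℂ) hk
    push_cast at this
    linear_combination this
  have hl' : (d : ℂ) - n = l + 1 := by
    have := congrArg (Int.cast : ℤ → ℂ) hl
    push_cast at this
    linear_combination this
  rw [intertwinerProfile, intertwinerProfile, intertwinerProfile,
    show (d + n).toNat = k + 1 by omega, show (d - n).toNat = l + 1 by omega,
    show (d + (n - 1)).toNat = k by omega, show (d - (n - 1)).toNat = l + 2 by omega,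
    show (d + (n + 1)).toNat = k + 2 by omega, show (d - (n + 1)).toNat = l by omega, hk', hl']
  rw [show ((2 * d : ℕ) : ℂ) - k = l + 2 by push_cast; linear_combination hk' + hl'] at key
  simp only [Nat.factorial_succ]
  push_cast
  linear_combination ((k : ℂ) + 1) * (k.factorial : ℂ) * (l + 1) * l.factorial * key

/-! ### From a profile to a combination of the u_j -/

theorem uVec_apply (d : ℕ) (ε : ℤˣ) (j : ℤ) (n : WIdx d) : uVec d ε j n =
    1 / 2 * ((if (n : ℤ) = j then 1 else 0) +
      ((ε : ℤ) : ℂ) * (-1) ^ d * (if (n : ℤ) = -j then 1 else 0)) := by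
  simp only [uVec, vVec, Pi.smul_apply, Pi.add_apply, smul_eq_mul]

theorem coe_units_mul_neg_one_pow_mul_self (ε : ℤˣ) (d : ℕ) :
    (((ε : ℤ) : ℂ) * (-1) ^ d) * (((ε : ℤ) : ℂ) * (-1) ^ d) = 1 := by
  rw [mul_mul_mul_comm, ← mul_pow]
  rcases Int.units_eq_one_or ε with rfl | rfl <;> simp

/-- A row vector with the symmetry of the `u_j^{d,ε}`, supported on the indices `k + 2j` and their
negatives, is the combination of the `u_j^{d,ε}` given by its entries at the `k + 2j`. -/
theorem exists_sum_smul_uVec_eq {d k : ℕ} {ε : ℤˣ} {c P : ℕ → ℂ} {x : WIdx d → ℂ} {H : ℤ → ℂ}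
    {C₀ : ℂ} (hC₀ : C₀ ≠ 0) (hx : ∀ n : WIdx d, x n = C₀ * H n / wignerWeight d n)
    (hneg : ∀ n : ℤ, |n| ≤ d → H (-n) = ((ε : ℤ) : ℂ) * (-1) ^ d * H n)
    (hpar : ∀ n : ℤ, |n| ≤ d → Odd (n - k) → H n = 0)
    (hsmall : ∀ n : ℤ, |n| < k → H n = 0)
    (hk0 : k = 0 → ((ε : ℤ) : ℂ) * (-1) ^ d = 1)
    (hne : ∃ n : ℤ, |n| ≤ d ∧ H n ≠ 0)
    (hc : ∀ j, 2 * j + k ≤ d → c j = if k = 0 ∧ j = 0 then 1 / 2 else P j)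
    (hP0 : P 0 = 1)
    (hP : ∀ j : ℕ, 2 * j + k ≤ d → H (2 * j + k) / wignerWeight d (2 * j + k) =
      P j * (H k / wignerWeight d k)) :
    ∃ C : ℂ, C ≠ 0 ∧ ∑ j ∈ (Finset.range (d + 1)).filter (fun j => 2 * j + k ≤ d),
      c j • uVec d ε (2 * j + k) = C • x := by
  have hss := coe_units_mul_neg_one_pow_mul_self ε d
  set s : ℂ := ((ε : ℤ) : ℂ) * (-1) ^ d with hs
  have hzero (n : ℤ) (hn : 0 ≤ n) (hnd : n ≤ d) (hnk : ∀ j : ℕ, n ≠ 2 * j + k) : H n = 0 := by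
    rcases Int.even_or_odd (n - k) with h | h
    · refine hsmall n ?_
      rw [abs_of_nonneg hn]
      by_contra! hlt
      obtain ⟨r, hr⟩ := h
      exact hnk r.toNat (by omega)
    · exact hpar n (by rw [abs_of_nonneg hn]; exact hnd) h
  -- All entries at k + 2j are multiples of the one at k, so H(k) = 0 would force H = 0.
  have hHk : H k ≠ 0 := by
    intro h0
    have hpos (n : ℤ) (hn : 0 ≤ n) (hnd : n ≤ d) : H n = 0 := by
      by_cases h : ∃ j : ℕ, n = 2 * j + k
      · obtain ⟨j, rfl⟩ := h
        have := hP j (by omega)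
        rw [h0, zero_div, mul_zero, div_eq_zero_iff] at this
        exact this.resolve_right (wignerWeight_ne_zero d _)
      · exact hzero n hn hnd (by push Not at h; exact h)
    obtain ⟨n, hn, hne⟩ := hne
    rw [abs_le] at hn
    rcases le_total 0 n with h | h
    · exact hne (hpos n h hn.2)
    · have := hneg (-n) (by rw [abs_neg, abs_le]; exact hn)
      rw [neg_neg, hpos (-n) (by omega) (by omega), mul_zero] at this
      exact hne this
  have hwk := wignerWeight_ne_zero d k
  refine ⟨1 / 2 * (wignerWeight d k / H k) / C₀,
    div_ne_zero (mul_ne_zero (by norm_num) (div_ne_zero hwk hHk)) hC₀, ?_⟩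
  set E : ℤ → ℂ := fun n => ∑ j ∈ (Finset.range (d + 1)).filter (fun j => 2 * j + k ≤ d),
    c j * (1 / 2 * ((if n = 2 * j + k then 1 else 0) + s * (if n = -(2 * j + k) then 1 else 0)))
    with hE
  have hEneg (n : ℤ) : E (-n) = s * E n := by
    simp only [hE, Finset.mul_sum, neg_eq_iff_eq_neg, neg_neg]
    refine Finset.sum_congr rfl fun j _ => ?_
    linear_combination -c j * (1 / 2 * (if n = -(2 * j + k) then 1 else 0)) * hss
  have hEpos (n : ℤ) (hn : 0 ≤ n) (hnd : n ≤ d) :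
      E n = 1 / 2 * (wignerWeight d k / H k) * (H n / wignerWeight d n) := by
    by_cases h : ∃ j : ℕ, n = 2 * j + k
    · obtain ⟨j₀, rfl⟩ := h
      rw [hE]
      dsimp only
      rw [Finset.sum_eq_single j₀, hP j₀ (by omega), hc j₀ (by omega), if_pos rfl]
      -- At index 0 the two halves of u_0 coincide and add up to v_0; the coefficient 1/2 restores
      -- the common normalization.
      · by_cases h0 : k = 0 ∧ j₀ = 0
        · rw [if_pos h0, if_pos (by omega), hk0 h0.1, h0.2, hP0]
          field_simp
          norm_num
        · rw [if_neg h0, if_neg (by omega)]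
          field_simp
          ring
      · intro j hj hne
        rw [Finset.mem_filter] at hj
        rw [if_neg (by omega), if_neg (by omega)]
        ring
      · intro hj
        rw [Finset.mem_filter, Finset.mem_range] at hj
        omega
    · push Not at h
      rw [hzero n hn hnd h, hE]
      dsimp only
      rw [Finset.sum_eq_zero]
      · simp
      · intro j _
        have h1 := h j
        rw [if_neg h1, if_neg (by omega)]
        ring
  ext n
  have hn := n.2
  rw [Finset.mem_Icc] at hn
  have hEn : (∑ j ∈ (Finset.range (d + 1)).filter (fun j => 2 * j + k ≤ d),
      c j • uVec d ε (2 * j + k)) n = E n := by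
    rw [Finset.sum_apply, hE]
    exact Finset.sum_congr rfl fun j _ => by
      rw [Pi.smul_apply, smul_eq_mul, uVec_apply]
  rw [hEn, Pi.smul_apply, smul_eq_mul, hx]
  have hgoal : E n = 1 / 2 * (wignerWeight d k / H k) * (H n / wignerWeight d n) := by
    rcases le_total 0 (n : ℤ) with h | h
    · exact hEpos n h hn.2
    · have h1 := hEneg (-(n : ℤ))
      have h2 := hneg (-(n : ℤ)) (by rw [abs_neg, abs_le]; exact hn)
      rw [neg_neg, hEpos (-(n : ℤ)) (by omega) (by omega), wignerWeight_neg] at h1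
      rw [neg_neg] at h2
      rw [h1, h2]
      ring
  rw [hgoal]
  field_simp

/-- The product in the definition of `g2Coeff`. -/
noncomputable def g2Prod (d : ℕ) (μ : Fin 3 → ℂ) (k j : ℕ) : ℂ :=
  (-1) ^ j * ∏ i ∈ Finset.range j,
    ((Real.sqrt (((d : ℝ) - 1 - 2 * i - k) * ((d : ℝ) - 2 * i - k)) : ℂ) *
        (3 * μ 2 + 2 * d - 1 + 2 * i + k)) /
      ((Real.sqrt (((d : ℝ) + 1 + 2 * i + k) * ((d : ℝ) + 2 + 2 * i + k)) : ℂ) *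
        (μ 0 - μ 1 - 1 - 2 * i - k))

/-- The square roots in g₂ are ratios of consecutive weights, which leaves only linear factors for
the profile. -/
theorem wignerWeight_add_two {d : ℕ} {n : ℤ} (h1 : -(d : ℤ) ≤ n) (h2 : n + 2 ≤ d) :
    Real.sqrt (((d : ℝ) + 1 + n) * (d + 2 + n)) * wignerWeight d n =
      Real.sqrt (((d : ℝ) - 1 - n) * (d - n)) * wignerWeight d (n + 2) := by
  obtain ⟨k, hk⟩ := Int.eq_ofNat_of_zero_le (by omega : 0 ≤ d + n)
  obtain ⟨l, hl⟩ := Int.eq_ofNat_of_zero_le (by omega : 0 ≤ d - (n + 2))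
  have hk' : (d : ℝ) + n = k := by exact_mod_cast congrArg (Int.cast : ℤ → ℝ) hk
  have hl' : (d : ℝ) - (n + 2) = l := by exact_mod_cast congrArg (Int.cast : ℤ → ℝ) hl
  rw [wignerWeight, wignerWeight, show (d + n).toNat = k by omega,
    show (d - n).toNat = l + 2 by omega, show (d + (n + 2)).toNat = k + 2 by omega,
    show (d - (n + 2)).toNat = l by omega, show (d : ℝ) + 1 + n = k + 1 by linarith,
    show (d : ℝ) + 2 + n = k + 2 by linarith, show (d : ℝ) - 1 - n = l + 1 by linarith,
    show (d : ℝ) - n = l + 2 by linarith, ← Real.sqrt_mul (by positivity),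
    ← Real.sqrt_mul (by positivity)]
  congr 1
  simp only [Nat.factorial_succ]
  push_cast
  ring

/-- The cutoff D allows a last step with zero denominator to be left out, as g₃ requires. -/
theorem div_wignerWeight_eq_g2Prod_mul {d k D : ℕ} (hD : D ≤ d) {μ : Fin 3 → ℂ} {H : ℤ → ℂ}
    (hstep : ∀ i : ℕ, 2 * i + k + 2 ≤ D → μ 0 - μ 1 - 1 - 2 * i - k ≠ 0 ∧
      (3 * μ 2 + 2 * d - 1 + 2 * i + k) * H (2 * i + k) =
        -(μ 0 - μ 1 - 1 - 2 * i - k) * H (2 * i + k + 2))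
    (j : ℕ) (hj : 2 * j + k ≤ D) : H (2 * j + k) / wignerWeight d (2 * j + k) =
      g2Prod d μ k j * (H k / wignerWeight d k) := by
  induction j with
  | zero => simp [g2Prod]
  | succ j ih =>
    have ih := ih (by omega)
    obtain ⟨hne, hs⟩ := hstep j (by omega)
    have hw := wignerWeight_add_two (d := d) (n := 2 * j + k) (by omega) (by omega)
    have hP : g2Prod d μ k (j + 1) = -(((Real.sqrt (((d : ℝ) - 1 - 2 * j - k) *
        ((d : ℝ) - 2 * j - k)) : ℂ) * (3 * μ 2 + 2 * d - 1 + 2 * j + k)) /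
        ((Real.sqrt (((d : ℝ) + 1 + 2 * j + k) * ((d : ℝ) + 2 + 2 * j + k)) : ℂ) *
        (μ 0 - μ 1 - 1 - 2 * j - k))) * g2Prod d μ k j := by
      rw [g2Prod, g2Prod, Finset.prod_range_succ, pow_succ]
      ring
    push_cast at hw
    rw [show (d : ℝ) + 1 + (2 * j + k) = d + 1 + 2 * j + k by ring,
      show (d : ℝ) + 2 + (2 * j + k) = d + 2 + 2 * j + k by ring,
      show (d : ℝ) - 1 - (2 * j + k) = d - 1 - 2 * j - k by ring,
      show (d : ℝ) - (2 * j + k) = d - 2 * j - k by ring] at hw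
    have hA : (Real.sqrt (((d : ℝ) + 1 + 2 * j + k) * ((d : ℝ) + 2 + 2 * j + k)) : ℂ) ≠ 0 := by
      exact_mod_cast (Real.sqrt_pos.mpr (by positivity)).ne'
    have hw' := congrArg (Complex.ofReal) hw
    rw [Complex.ofReal_mul, Complex.ofReal_mul] at hw'
    rw [hP, mul_assoc, ← ih, show 2 * ((j + 1 : ℕ) : ℤ) + k = 2 * j + k + 2 by push_cast; ring]
    generalize (Real.sqrt (((d : ℝ) + 1 + 2 * j + k) * ((d : ℝ) + 2 + 2 * j + k)) : ℂ) = A at *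
    generalize (Real.sqrt (((d : ℝ) - 1 - 2 * j - k) * ((d : ℝ) - 2 * j - k)) : ℂ) = B at *
    have n1 := wignerWeight_ne_zero d (2 * j + k)
    have n2 := wignerWeight_ne_zero d (2 * j + k + 2)
    generalize (wignerWeight d (2 * j + k) : ℂ) = w1 at *
    generalize (wignerWeight d (2 * j + k + 2) : ℂ) = w2 at *
    generalize H (2 * j + k) = H1 at *
    generalize H (2 * j + k + 2) = H2 at *
    generalize μ 0 - μ 1 - 1 - 2 * (j : ℂ) - k = p at *
    generalize 3 * μ 2 + 2 * (d : ℂ) - 1 + 2 * j + k = r at *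
    rw [div_eq_iff n2]
    field_simp
    linear_combination p * H2 * hw' + B * w2 * hs

theorem neg_one_zpow_of_even_sub {m n : ℤ} (h : Even (m - n)) : ((-1 : ℂ) ^ m) = (-1) ^ n := by
  rw [show m = (m - n) + n by ring, zpow_add₀ (by norm_num), h.neg_one_zpow, one_mul]

theorem neg_one_zpow_mul_of_odd_sub {m n : ℤ} (h : Odd (m - n)) :
    ((-1 : ℂ) ^ n) * (-1) ^ m = -1 := by
  rw [← zpow_add₀ (by norm_num), show n + m = (m - n) + 2 * n by ring, zpow_add₀ (by norm_num),
    h.neg_one_zpow, (even_two_mul n).neg_one_zpow, mul_one]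

theorem intertwinerProfile_eq_zero_of_odd {d k : ℕ} {u : ℂ} (hu : 0 < u.re) {ε : ℤˣ} {q : ℤ → ℂ}
    {τ : ℂ} (hτ : ∀ m, q (-m) = τ * q m) (hsign : ((ε : ℤ) : ℂ) * τ * (-1) ^ d = (-1) ^ k)
    {n : ℤ} (hn : |n| ≤ d) (hodd : Odd (n - k)) : intertwinerProfile d u ε q n = 0 := by
  have h := intertwinerProfile_parity (ε := ε) hu hτ hn
  rw [hsign, ← zpow_natCast, neg_one_zpow_mul_of_odd_sub hodd] at h
  linear_combination h / 2

theorem exists_sum_smul_uVec_eq_vecMul {d k : ℕ} {ν : Fin 3 → ℂ} {ε : ℤˣ} {j : ℤ} (hj : |j| ≤ d)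
    {q : ℤ → ℂ} {c : ℂ} (hc : c ≠ 0)
    (hq : ∀ m : ℤ, |m| ≤ d → wignerFlip d j m = c * q m / wignerWeight d m)
    {u τ : ℂ} (hν : ν 2 - ν 1 = u) (hu : 0 < u.re) (hτ : ∀ m, q (-m) = τ * q m)
    (hsign : ((ε : ℤ) : ℂ) * τ * (-1) ^ d = (-1) ^ k)
    (hk0 : k = 0 → ((ε : ℤ) : ℂ) * (-1) ^ d = 1) (hkd : k ≤ d)
    (hsmall : ∀ n : ℤ, |n| < k → Even (n - k) → intertwinerProfile d u ε q n = 0)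
    (hne : ∃ m : ℤ, |m| ≤ d ∧ ((ε : ℤ) : ℂ) = (-1) ^ m ∧ q m * gammaEntry u m ≠ 0)
    {b P : ℕ → ℂ} (hb : ∀ j, 2 * j + k ≤ d → b j = if k = 0 ∧ j = 0 then 1 / 2 else P j)
    (hP0 : P 0 = 1)
    (hP : ∀ j : ℕ, 2 * j + k ≤ d →
      intertwinerProfile d u ε q (2 * j + k) / wignerWeight d (2 * j + k) =
        P j * (intertwinerProfile d u ε q k / wignerWeight d k)) :
    ∃ C : ℂ, C ≠ 0 ∧ ∑ j ∈ (Finset.range (d + 1)).filter (fun j => 2 * j + k ≤ d),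
      b j • uVec d ε (2 * j + k) = C • (uVec d ε j ᵥ* intertwinerW3 d ν) := by
  obtain ⟨C₀, hC₀, hx⟩ := exists_uVec_vecMul_intertwinerW3 d ν ε hj hc hq
  rw [hν] at hx
  have hpar (n : ℤ) (hn : |n| ≤ d) (h : Odd (n - k)) :=
    intertwinerProfile_eq_zero_of_odd hu hτ hsign hn h
  refine exists_sum_smul_uVec_eq hC₀ hx (fun n hn => intertwinerProfile_neg u ε q hn) hpar
    (fun n hn => ?_) hk0 (exists_intertwinerProfile_ne_zero hne) hb hP0 hP
  rcases Int.even_or_odd (n - k) with h | h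
  · exact hsmall n hn h
  · exact hpar n (by omega) h

/-! ### Nonvanishing, and the row d of T(w₃) -/

theorem exists_eq_neg_one_zpow (d : ℕ) (ε : ℤˣ) :
    ∃ m : ℤ, (m = -d ∨ m = 1 - d) ∧ ((ε : ℤ) : ℂ) = (-1) ^ m := by
  rcases Int.units_eq_one_or ε with rfl | rfl <;> rcases Int.even_or_odd (d : ℤ) with h | h
  · exact ⟨-d, Or.inl rfl, by simp [h.neg.neg_one_zpow]⟩
  · exact ⟨1 - d, Or.inr rfl, by simp [(odd_one.sub_odd h).neg_one_zpow]⟩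
  · exact ⟨1 - d, Or.inr rfl, by simp [(odd_one.sub_even h).neg_one_zpow]⟩
  · exact ⟨-d, Or.inl rfl, by simp [h.neg.neg_one_zpow]⟩

/-- One of m = -d, 1-d has the required parity, and Re u < d ≤ 1 - m puts both Gamma arguments in
the right half plane. The condition m ≠ 0 keeps q(m) = m nonzero too. -/
theorem exists_gammaEntry_ne_zero {d : ℕ} (hd : 2 ≤ d) (ε : ℤˣ) {u : ℂ} (hu : 0 < u.re)
    (hud : u.re < d) :
    ∃ m : ℤ, m ≠ 0 ∧ |m| ≤ d ∧ ((ε : ℤ) : ℂ) = (-1) ^ m ∧ gammaEntry u m ≠ 0 := by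
  obtain ⟨m, hm, hε⟩ := exists_eq_neg_one_zpow d ε
  refine ⟨m, by omega, by rw [abs_le]; omega, hε, gammaEntry_ne_zero hu (by omega) ?_⟩
  have : (d : ℝ) ≤ 1 - m := by exact_mod_cast (by omega : (d : ℤ) ≤ 1 - m)
  linarith

theorem intertwinerProfile_one_add_two {d : ℕ} {u : ℂ} (hu : 0 < u.re) (ε : ℤˣ)
    {n : ℤ} (h1 : -(d : ℤ) ≤ n) (h2 : n + 2 ≤ d) :
    (d + n - u) * intertwinerProfile d u ε (fun _ => 1) n =
      (u - d + n + 2) * intertwinerProfile d u ε (fun _ => 1) (n + 2) :=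
  intertwinerProfile_add_two (fun m _ _ _ => by
    rw [one_mul, one_mul]; exact gammaEntry_add_two hu m) h1 h2

theorem wignerFlip_top_coeff_ne_zero (d : ℕ) : (-1 / 2 : ℂ) ^ d * wignerWeight d d ≠ 0 :=
  mul_ne_zero (pow_ne_zero _ (by norm_num)) (wignerWeight_ne_zero d d)

/-- The two conditions on μ rewrite the linear factors of g₂ at n = 2i + k as d+n-u and d-2-u-n,
those of the profile recurrence up to sign. -/
theorem exists_g2Coeff_sum_eq {d k : ℕ} (hd : 2 ≤ d) {μ ν : Fin 3 → ℂ} {ε : ℤˣ} {u : ℂ}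
    (hν : ν 2 - ν 1 = u) (hu : 0 < u.re) (hud : u.re < d) (hμ : 3 * μ 2 + 2 * d - 1 = d - u)
    (hμ' : μ 0 - μ 1 - 1 = d - 2 - u)
    (hnz : ∀ i : ℕ, 2 * i + k + 2 ≤ d → (d : ℂ) - 2 - u - 2 * i - k ≠ 0)
    (hsign : ((ε : ℤ) : ℂ) * (-1) ^ d = (-1) ^ k) (hkd : k ≤ d)
    (hsmall : ∀ n : ℤ, |n| < k → Even (n - k) →
      intertwinerProfile d u ε (fun _ => 1) n = 0) :
    ∃ C : ℂ, C ≠ 0 ∧ ∑ j ∈ (Finset.range (d + 1)).filter (fun j => 2 * j + k ≤ d),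
      g2Coeff d μ k j • uVec d ε (2 * j + k) = C • (uVec d ε d ᵥ* intertwinerW3 d ν) := by
  obtain ⟨m, _, hm, hε, hF⟩ := exists_gammaEntry_ne_zero hd ε hu hud
  refine exists_sum_smul_uVec_eq_vecMul (q := fun _ => 1) (τ := 1) (P := g2Prod d μ k)
    (by simp) (wignerFlip_top_coeff_ne_zero d)
    (fun m hm => by rw [wignerFlip_top d hm, mul_one]) hν hu (by simp) (by rw [mul_one, hsign])
    (fun h => by rw [hsign, h, pow_zero]) hkd hsmall ⟨m, hm, hε, by rwa [one_mul]⟩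
    (fun j _ => rfl) (by simp [g2Prod])
    (fun j hj => div_wignerWeight_eq_g2Prod_mul le_rfl (fun i hi => ?_) j hj)
  have hr := intertwinerProfile_one_add_two hu ε (d := d) (n := 2 * i + k) (by omega) (by omega)
  rw [hμ, hμ']
  refine ⟨hnz i hi, ?_⟩
  push_cast at hr
  linear_combination hr

/-- At u = κ - 1 the recurrence reads (κ+n) H(n) = (n+2-κ) H(n+2). At n = κ - 2 the right side
vanishes, and the zero propagates downwards as long as κ + n ≠ 0. -/
theorem intertwinerProfile_eq_zero_of_abs_lt {d κ : ℕ} (hκ : 2 ≤ κ) (hd : d + 1 = 2 * κ) (ε : ℤˣ)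
    {n : ℤ} (hn : |n| < κ) (heven : Even (n - κ)) :
    intertwinerProfile d ((κ : ℂ) - 1) ε (fun _ => 1) n = 0 := by
  have hu : 0 < ((κ : ℂ) - 1).re := by
    have : (2 : ℝ) ≤ κ := by exact_mod_cast hκ
    simp; linarith
  have hd' : (d : ℂ) + 1 = 2 * κ := by exact_mod_cast hd
  have key (i : ℕ) : i + 2 ≤ κ →
      intertwinerProfile d ((κ : ℂ) - 1) ε (fun _ => 1) (κ - 2 - 2 * i) = 0 := by
    induction i with
    | zero =>
      intro _
      have := intertwinerProfile_one_add_two hu ε (d := d) (n := κ - 2) (by omega) (by omega)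
      rw [show ((κ : ℂ) - 1) - d + ((κ - 2 : ℤ) : ℂ) + 2 = 0 by
        push_cast; linear_combination -hd', zero_mul, mul_eq_zero] at this
      rw [Nat.cast_zero, mul_zero, sub_zero]
      refine this.resolve_left fun h => ?_
      have h2 : ((2 * κ - 2 : ℤ) : ℂ) = 0 := by
        push_cast at h ⊢
        linear_combination h - hd'
      have h3 : (2 * κ - 2 : ℤ) = 0 := by exact_mod_cast h2
      omega
    | succ i ih =>
      intro hi
      have := intertwinerProfile_one_add_two hu ε (d := d) (n := κ - 2 - 2 * (i + 1 : ℕ))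
        (by omega) (by omega)
      rw [show (κ : ℤ) - 2 - 2 * (i + 1 : ℕ) + 2 = κ - 2 - 2 * i by push_cast; ring,
        ih (by omega), mul_zero, mul_eq_zero] at this
      refine this.resolve_left fun h => ?_
      have h2 : ((2 * κ - 2 - 2 * (i + 1) : ℤ) : ℂ) = 0 := by
        push_cast at h ⊢
        linear_combination h - hd'
      have h3 : (2 * κ - 2 - 2 * (i + 1) : ℤ) = 0 := by exact_mod_cast h2
      omega
  obtain ⟨r, hr⟩ := heven
  rw [abs_lt] at hn
  have := key (-r - 1).toNat (by omega)
  rwa [show (κ : ℤ) - 2 - 2 * ((-r - 1).toNat : ℤ) = n by omega] at this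

/-! ### The Weyl action and rows of T(w₄) -/

theorem weylAct_weylW3 (μ : Fin 3 → ℂ) : weylAct weylW3 μ = ![μ 0, μ 2, μ 1] := by
  ext j
  fin_cases j <;> simp [weylAct, weylW3, Fin.sum_univ_three]

theorem weylAct_weylW5 (μ : Fin 3 → ℂ) : weylAct weylW5 μ = ![μ 1, μ 2, μ 0] := by
  ext j
  fin_cases j <;> simp [weylAct, weylW5, Fin.sum_univ_three]

/-- The common shape of the two identities for `T^d(w₄, μ^{w₅})`: if the profile of
`u_j^{d,ε} T^d(w₃, μ^{w₅})` is constant from `κ` on, then multiplication by `T^d(w₂, ·)` gives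
`g₄`. -/
theorem exists_g4_eq_vecMul_intertwinerW4 {d κ : ℕ} (hκ : 2 ≤ κ) (hd : d + 1 = 2 * κ)
    {μ : Fin 3 → ℂ} (hμ : μ = ![((d : ℂ) - 1) / 2, 0, -(((d : ℂ) - 1) / 2)])
    {ε ε' : ℤˣ} {j : ℤ} (hj : |j| ≤ d) {q : ℤ → ℂ} {c : ℂ} (hc : c ≠ 0)
    (hq : ∀ m : ℤ, |m| ≤ d → wignerFlip d j m = c * q m / wignerWeight d m)
    {τ : ℂ} (hτ : ∀ m, q (-m) = τ * q m)
    (hsign : ((ε : ℤ) : ℂ) * τ * (-1) ^ d = (-1) ^ κ)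
    (hε : ((ε' : ℤ) : ℂ) = ((ε : ℤ) : ℂ) * (-1) ^ κ) {η : ℂ} (hη : η ≠ 0)
    (hconst : ∀ n : ℤ, κ ≤ n → n ≤ d → Even (n - κ) →
      intertwinerProfile d ((d : ℂ) - 1) ε q n = η) :
    ∃ C : ℂ, C ≠ 0 ∧
      g4 d μ ε' = C • (uVec d ε j ᵥ* intertwinerW4 d (weylAct weylW5 μ)) := by
  have hd' : (d : ℂ) + 1 = 2 * κ := by exact_mod_cast hd
  have hU : 0 < ((d : ℂ) - 1).re := by
    have : (2 : ℝ) ≤ d := by exact_mod_cast (by omega : 2 ≤ d)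
    simp; linarith
  have huκ : (κ : ℂ) - 1 = ((κ - 1 : ℕ) : ℂ) := by
    rw [Nat.cast_sub (by omega), Nat.cast_one]
  have hu : 0 < ((κ : ℂ) - 1).re := by
    have : (2 : ℝ) ≤ κ := by exact_mod_cast hκ
    simp; linarith
  obtain ⟨C₀, hC₀, hx⟩ := exists_uVec_vecMul_intertwinerW3 d (weylAct weylW5 μ) ε hj hc hq
  have hν : (weylAct weylW5 μ) 2 - (weylAct weylW5 μ) 1 = (d : ℂ) - 1 := by
    rw [weylAct_weylW5, hμ]
    simp
  rw [hν] at hx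
  have hpi (z : ℂ) : ((Real.pi : ℂ) ^ z) ≠ 0 := by
    rw [Ne, Complex.cpow_eq_zero_iff]
    simp [Real.pi_ne_zero]
  have hpar (n : ℤ) (hn : |n| ≤ d) (h : Odd (n - κ)) :=
    intertwinerProfile_eq_zero_of_odd hU hτ hsign hn h
  set H : ℤ → ℂ := fun n => intertwinerProfile d ((d : ℂ) - 1) ε q n * gammaEntry ((κ : ℂ) - 1) n
    with hH
  set z : ℂ := (weylAct weylW3 (weylAct weylW5 μ)) 0 - (weylAct weylW3 (weylAct weylW5 μ)) 1
    with hz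
  have hz' : (weylAct weylW3 (weylAct weylW5 μ)) 1 - (weylAct weylW3 (weylAct weylW5 μ)) 0 =
      (κ : ℂ) - 1 := by
    rw [weylAct_weylW5, weylAct_weylW3, hμ]
    simp
    linear_combination hd' / 2
  have hx' (n : WIdx d) : (uVec d ε j ᵥ* intertwinerW4 d (weylAct weylW5 μ)) n =
      (C₀ * (Real.pi : ℂ) ^ z) * H n / wignerWeight d n := by
    rw [intertwinerW4, ← vecMul_vecMul, intertwinerW2, vecMul_smul, Pi.smul_apply, smul_eq_mul,
      gammaW, vecMul_diagonal, hx, hz']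
    change _ * (_ * gammaEntry ((κ : ℂ) - 1) n) = _
    rw [hH]
    ring
  -- As the first profile is constant here, H has the ratios of the Gamma factors at κ - 1, with
  -- linear factors 2i+2 and 2i+2κ, the same as in g₄.
  have hstep (i : ℕ) (hi : 2 * i + κ + 2 ≤ d) : μ 0 - μ 1 - 1 - 2 * i - κ ≠ 0 ∧
      (3 * μ 2 + 2 * d - 1 + 2 * i + κ) * H (2 * i + κ) =
        -(μ 0 - μ 1 - 1 - 2 * i - κ) * H (2 * i + κ + 2) := by
    have e1 : μ 0 - μ 1 - 1 - 2 * i - κ = -(2 * i + 2) := by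
      rw [hμ]; simp; linear_combination hd' / 2
    have e2 : 3 * μ 2 + 2 * d - 1 + 2 * i + κ = 2 * i + 2 * κ := by
      rw [hμ]; simp; linear_combination hd' / 2
    have h1 := gammaEntry_add_two hu (2 * i + κ)
    have h2 := hconst (2 * i + κ) (by omega) (by omega) (by simp)
    have h3 := hconst (2 * i + κ + 2) (by omega) (by omega) ⟨i + 1, by ring⟩
    rw [e1, e2, hH]
    dsimp only
    rw [h2, h3]
    refine ⟨neg_ne_zero.mpr (by exact_mod_cast (by omega : 2 * i + 2 ≠ 0)), ?_⟩
    push_cast at h1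
    linear_combination -η * h1
  refine exists_sum_smul_uVec_eq (k := (d + 1) / 2) (P := g2Prod d μ κ)
    (mul_ne_zero hC₀ (hpi z)) hx' ?_ ?_ ?_ ?_ ?_ ?_ (by simp [g2Prod]) ?_
  · intro n hn
    have h1 := intertwinerProfile_neg ((d : ℂ) - 1) ε q hn
    simp only [hH]
    rcases Int.even_or_odd (n - κ) with h | h
    -- Reflecting the second Gamma factor costs (-1)^n = (-1)^κ, which is why the sign of g₄ differs
    -- from that of u_j by (-1)^κ.
    · rw [h1, gammaEntry_neg hu, hε, neg_one_zpow_of_even_sub h, zpow_natCast]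
      ring
    · rw [h1, hpar n hn h]
      ring
  · intro n hn h
    rw [hH]
    dsimp only
    rw [hpar n hn (by rwa [show (d + 1) / 2 = κ by omega] at h), zero_mul]
  · intro n hn
    rw [show (d + 1) / 2 = κ by omega] at hn
    rcases Int.even_or_odd (n - κ) with h | h
    · rw [hH]
      dsimp only
      rw [huκ, gammaEntry_eq_zero (by omega) (by omega)
        (by rw [show n + ((κ - 1 : ℕ) : ℤ) + 1 = (n - κ) + 2 * κ by omega]
            exact h.add (even_two_mul _)), mul_zero]
    · rw [hH]
      dsimp only
      rw [hpar n (by omega) h, zero_mul]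
  · intro h
    omega
  · refine ⟨κ, by rw [abs_le]; omega, ?_⟩
    rw [hH]
    dsimp only
    rw [hconst κ le_rfl (by omega) (by simp)]
    refine mul_ne_zero hη ?_
    have h1 := gammaEntry_ne_zero hu (m := -κ) (by omega) (by simp; linarith)
    rw [gammaEntry_neg hu] at h1
    exact right_ne_zero_of_mul h1
  · intro i _
    rw [g2Coeff, show (d + 1) / 2 = κ by omega]
    rfl
  · intro i hi
    rw [show (d + 1) / 2 = κ by omega] at hi ⊢
    exact div_wignerWeight_eq_g2Prod_mul le_rfl hstep i hi

/-! ### The vector g₃ at u = d - 1 -/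

theorem wignerWeight_sub_two {d : ℕ} (hd : 2 ≤ d) :
    (wignerWeight d (d - 2) : ℂ) * (Real.sqrt (d * (2 * d - 1)) : ℂ) = wignerWeight d d := by
  have h := wignerWeight_add_two (d := d) (n := d - 2) (by omega) (by omega)
  push_cast at h
  rw [sub_add_cancel, show ((d : ℝ) + 1 + (d - 2)) * (d + 2 + (d - 2)) = 2 * (d * (2 * d - 1)) by ring,
    show ((d : ℝ) - 1 - (d - 2)) * (d - (d - 2)) = 2 by ring, Real.sqrt_mul (by norm_num),
    mul_assoc] at h
  have h2 := mul_left_cancel₀ (Real.sqrt_pos.mpr (by norm_num : (0 : ℝ) < 2)).ne' h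
  rw [← h2]
  push_cast
  ring

theorem exists_g3_eq_vecMul {d k : ℕ} (hd : 2 ≤ d) (hk : k ≤ 1) {μ : Fin 3 → ℂ}
    (hμ : μ = ![(d : ℂ) - 1, 0, 1 - (d : ℂ)]) {j : ℤ} (hj : |j| ≤ d) {q : ℤ → ℂ} {c : ℂ}
    (hc : c ≠ 0) (hq : ∀ m : ℤ, |m| ≤ d → wignerFlip d j m = c * q m / wignerWeight d m)
    (hτ : ∀ m, q (-m) = (-1) ^ k * q m) (hq0 : ∀ m, m ≠ 0 → q m ≠ 0)
    (hrec : ∀ m : ℤ, -(d : ℤ) ≤ m → m + 2 ≤ d → Even (m - d) →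
      ((m : ℂ) + 1 - (d - 1)) * (q (m + 2) * gammaEntry ((d : ℂ) - 1) (m + 2)) =
        (m + 1 + (d - 1)) * (q m * gammaEntry ((d : ℂ) - 1) m)) :
    ∃ C : ℂ, C ≠ 0 ∧ g3 d μ k ((-1) ^ d) =
      C • (uVec d ((-1) ^ d) j ᵥ* intertwinerW3 d (weylAct weylW3 μ)) := by
  have hdd : ((-1 : ℂ) ^ d) * (-1) ^ d = 1 := by rw [← mul_pow]; simp
  have hε : ((((-1) ^ d : ℤˣ) : ℤ) : ℂ) = (-1) ^ d := by push_cast; rfl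
  have hd2 : (2 : ℝ) ≤ d := by exact_mod_cast hd
  have hu : 0 < ((d : ℂ) - 1).re := by simp; linarith
  obtain ⟨m, hm0, hm, hεm, hF⟩ := exists_gammaEntry_ne_zero hd ((-1) ^ d) hu (by simp)
  set H := intertwinerProfile d ((d : ℂ) - 1) ((-1) ^ d) q
  -- Both factors of the recurrence equal n + 1, which is nonzero for n ≥ 0.
  have hstep (n : ℤ) (h0 : 0 ≤ n) (h2 : n + 2 ≤ d) : H n = H (n + 2) := by
    have := intertwinerProfile_add_two (q := q) (ε := (-1) ^ d) (u := (d : ℂ) - 1) (d := d)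
      (n := n) (fun m h1 h2 h3 => hrec m h1 h2 ?_) (by omega) h2
    · have hn : (n : ℂ) + 1 ≠ 0 := by exact_mod_cast (by omega : n + 1 ≠ 0)
      refine mul_left_cancel₀ hn ?_
      linear_combination this
    · by_contra hodd
      rw [Int.not_even_iff_odd] at hodd
      have h4 := neg_one_zpow_mul_of_odd_sub hodd
      rw [← h3, zpow_natCast, hε, hdd] at h4
      norm_num at h4
  -- The denominator d-2-2i-k vanishes exactly at the step from d-2 to d. That step is replaced by
  -- H(d) = H(d-2) and the weight ratio √(d(2d-1)).
  have hprod := div_wignerWeight_eq_g2Prod_mul (d := d) (k := k) (D := d - 1) (by omega) (μ := μ)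
    (H := H) (fun i hi => by
      have e1 : μ 0 - μ 1 - 1 - 2 * i - k = ((d - 2 - 2 * i - k : ℤ) : ℂ) := by
        rw [hμ]; simp; ring
      have e2 : 3 * μ 2 + 2 * d - 1 + 2 * i + k = -((d - 2 - 2 * i - k : ℤ) : ℂ) := by
        rw [hμ]; simp; ring
      rw [e1, e2, hstep (2 * i + k) (by omega) (by omega)]
      exact ⟨by exact_mod_cast (by omega : (d - 2 - 2 * i - k : ℤ) ≠ 0), rfl⟩)
  refine exists_sum_smul_uVec_eq_vecMul (τ := (-1) ^ k) (u := (d : ℂ) - 1) (b := g3Coeff d μ k)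
    (P := fun j => if 2 * j + k < d then g2Prod d μ k j else
      g2Prod d μ k (j - 1) / (Real.sqrt (d * (2 * d - 1)) : ℂ)) hj hc hq ?_ hu hτ ?_ ?_ (by omega)
    ?_ ⟨m, hm, hεm, mul_ne_zero (hq0 m hm0) hF⟩ ?_ ?_ ?_
  · rw [weylAct_weylW3, hμ]
    simp
  · rw [hε]
    linear_combination (-1) ^ k * hdd
  · intro _
    rw [hε, hdd]
  · rintro n hn ⟨r, hr⟩
    rw [abs_lt] at hn
    omega
  · intro j hj
    rw [g3Coeff]
    by_cases h : 2 * j + k < d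
    · rw [if_pos h, if_pos h]; rfl
    · rw [if_neg h, if_neg h, if_neg (show ¬(k = 0 ∧ j = 0) by omega)]
      by_cases h2 : d = 2
      · rw [if_pos h2, g2Coeff, if_pos (by omega), show j - 1 = 0 by omega]
        simp [g2Prod]
      · rw [if_neg h2, g2Coeff, if_neg (by omega), one_mul]
        rfl
  · rw [if_pos (by omega)]
    simp [g2Prod]
  · intro j hj
    change H _ / _ = _ * (H _ / _)
    by_cases h : 2 * j + k < d
    · rw [if_pos h]
      exact hprod j (by omega)
    · rw [if_neg h]
      obtain ⟨i, rfl⟩ : ∃ i, j = i + 1 := ⟨j - 1, by omega⟩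
      have h1 := hprod i (by omega)
      have e1 : 2 * ((i + 1 : ℕ) : ℤ) + k = d := by omega
      have e2 : 2 * (i : ℤ) + k = d - 2 := by omega
      have h2 := hstep (d - 2) (by omega) (by omega)
      have hs : (Real.sqrt (d * (2 * d - 1)) : ℂ) ≠ 0 := by
        exact Complex.ofReal_ne_zero.mpr (Real.sqrt_pos.mpr (mul_pos (by linarith) (by linarith))).ne'
      rw [sub_add_cancel] at h2
      rw [e2] at h1
      rw [e1, Nat.add_sub_cancel, ← h2, ← wignerWeight_sub_two hd, div_mul_eq_mul_div, ← h1,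
        div_div]

/-! ### The parameters of the proposition -/

theorem exists_g2Coeff_sum_eq_of_odd {d κ k : ℕ} (hκ : 2 ≤ κ) (hd : d + 1 = 2 * κ) {μ : Fin 3 → ℂ}
    (hμ : μ = ![((d : ℂ) - 1) / 2, 0, -(((d : ℂ) - 1) / 2)]) {ε : ℤˣ}
    (hsign : ((ε : ℤ) : ℂ) * (-1) ^ d = (-1) ^ k)
    (hk : k ≤ 1 ∧ Odd ((κ : ℤ) - k) ∨ k = κ) :
    ∃ C : ℂ, C ≠ 0 ∧ ∑ j ∈ (Finset.range (d + 1)).filter (fun j => 2 * j + k ≤ d),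
      g2Coeff d μ k j • uVec d ε (2 * j + k) =
        C • (uVec d ε d ᵥ* intertwinerW3 d (weylAct weylW3 μ)) := by
  have hd' : (d : ℂ) + 1 = 2 * κ := by exact_mod_cast hd
  have hdr : (d : ℝ) + 1 = 2 * κ := by exact_mod_cast hd
  have hκr : (2 : ℝ) ≤ κ := by exact_mod_cast hκ
  refine exists_g2Coeff_sum_eq (u := (κ : ℂ) - 1) (by omega) ?_ (by simp; linarith)
    (by simp; linarith) ?_ ?_ ?_ hsign (by omega) ?_
  · rw [weylAct_weylW3, hμ]
    simp
    linear_combination hd' / 2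
  · rw [hμ]
    simp
    linear_combination -hd' / 2
  · rw [hμ]
    simp
    linear_combination -hd' / 2
  -- The denominator is κ-2-2i-k: nonzero by parity when k and κ differ modulo 2, and negative when
  -- k = κ.
  · intro i hi h
    have h2 : ((κ - 2 - 2 * i - k : ℤ) : ℂ) = 0 := by
      push_cast
      linear_combination h - hd'
    have h3 : (κ - 2 - 2 * i - k : ℤ) = 0 := by exact_mod_cast h2
    rcases hk with ⟨_, r, hr⟩ | hk <;> omega
  · intro n hn he
    rcases hk with ⟨hk, _⟩ | rfl
    · obtain ⟨r, hr⟩ := he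
      rw [abs_lt] at hn
      omega
    · exact intertwinerProfile_eq_zero_of_abs_lt hκ hd ε hn he

theorem exists_g2_eq_vecMul {d k : ℕ} (hd : 2 ≤ d) {t : ℝ} (ht : Even d ∨ t ≠ 0) {μ : Fin 3 → ℂ}
    (hμ : μ = ![((d : ℂ) - 1) / 2 + Complex.I * t, -2 * Complex.I * t,
      -(((d : ℂ) - 1) / 2) + Complex.I * t]) (hk : k ≤ 1) {ε : ℤˣ}
    (hsign : ((ε : ℤ) : ℂ) * (-1) ^ d = (-1) ^ k) :
    ∃ C : ℂ, C ≠ 0 ∧ g2 d μ k ε =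
      C • (uVec d ε d ᵥ* intertwinerW3 d (weylAct weylW3 μ)) := by
  have hd2 : (2 : ℝ) ≤ d := by exact_mod_cast hd
  have hre : (((d : ℂ) - 1) / 2 - 3 * Complex.I * t).re = ((d : ℝ) - 1) / 2 := by simp
  refine exists_g2Coeff_sum_eq (u := ((d : ℂ) - 1) / 2 - 3 * Complex.I * t) hd ?_
    (by rw [hre]; linarith) (by rw [hre]; linarith) ?_ ?_ ?_ hsign (by omega) ?_
  · rw [weylAct_weylW3, hμ]
    simp
    ring
  · rw [hμ]
    simp
    ring
  · rw [hμ]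
    simp
    ring
  -- The imaginary part of the denominator is 3t. For t = 0 the real part vanishes only if d - 3 is
  -- even, so d even or t ≠ 0 suffices.
  · intro i hi h
    have him := congrArg Complex.im h
    have hre' := congrArg Complex.re h
    simp at him hre'
    rcases ht with ⟨r, hr⟩ | ht
    · have h3 : (d : ℝ) - 3 = 2 * (2 * i + k) := by linarith
      have h4 : (d : ℤ) - 3 = 2 * (2 * i + k) := by exact_mod_cast h3
      omega
    · exact ht him
  · rintro n hn ⟨r, hr⟩
    rw [abs_lt] at hn
    omega

/-- At the parameter `d - 1` the profile of `u_d^{d,ε}` is constant on the positive indices of its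
parity class. -/
theorem exists_intertwinerProfile_eq_const {d : ℕ} (hd : 2 ≤ d) (hodd : Odd d) :
    ∃ η : ℂ, η ≠ 0 ∧ ∀ n : ℤ, 0 < n → n ≤ d → Odd n →
      intertwinerProfile d ((d : ℂ) - 1) 1 (fun _ => 1) n = η := by
  have hd2 : (2 : ℝ) ≤ d := by exact_mod_cast hd
  have hu : 0 < ((d : ℂ) - 1).re := by simp; linarith
  have key (i : ℕ) : 2 * i + 1 ≤ d →
      intertwinerProfile d ((d : ℂ) - 1) 1 (fun _ => 1) (2 * i + 1) =
        intertwinerProfile d ((d : ℂ) - 1) 1 (fun _ => 1) 1 := by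
    induction i with
    | zero => simp
    | succ i ih =>
      intro hi
      rw [← ih (by omega)]
      have := intertwinerProfile_one_add_two hu 1 (d := d) (n := 2 * i + 1) (by omega) (by omega)
      have hn : (2 * (i : ℂ) + 2) ≠ 0 := by exact_mod_cast (by omega : 2 * i + 2 ≠ 0)
      refine mul_left_cancel₀ hn ?_
      rw [show 2 * ((i + 1 : ℕ) : ℤ) + 1 = 2 * i + 1 + 2 by push_cast; ring]
      push_cast at this
      linear_combination -this
  have key' (n : ℤ) (h0 : 0 < n) (hn : n ≤ d) (ho : Odd n) :
      intertwinerProfile d ((d : ℂ) - 1) 1 (fun _ => 1) n =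
        intertwinerProfile d ((d : ℂ) - 1) 1 (fun _ => 1) 1 := by
    obtain ⟨r, hr⟩ := ho
    have := key r.toNat (by omega)
    rwa [show 2 * (r.toNat : ℤ) + 1 = n by omega] at this
  refine ⟨_, fun h0 => ?_, key'⟩
  -- Were the constant zero, reflection and the parity rule would make the whole profile vanish,
  -- against injectivity of the transform.
  obtain ⟨m, _, hm, hε, hF⟩ := exists_gammaEntry_ne_zero hd 1 hu (by simp)
  obtain ⟨n, hn, hne⟩ := exists_intertwinerProfile_ne_zero (q := fun _ => 1)
    ⟨m, hm, hε, by rwa [one_mul]⟩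
  have hpar := intertwinerProfile_eq_zero_of_odd (k := 1) hu (ε := 1) (q := fun _ => 1) (τ := 1)
    (by simp) (by simp [hodd.neg_one_pow]) hn
  have hn' := abs_le.mp hn
  rcases Int.even_or_odd n with h | h
  · exact hne (hpar (by exact h.sub_odd odd_one))
  · rcases lt_trichotomy n 0 with h1 | h1 | h1
    · have := intertwinerProfile_neg (d := d) ((d : ℂ) - 1) 1 (fun _ => 1) (n := -n)
        (by rwa [abs_neg])
      rw [neg_neg, key' (-n) (by omega) (by omega) h.neg, h0, mul_zero] at this
      exact hne this
    · subst h1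
      exact absurd h (by decide)
    · exact hne ((key' n h1 hn'.2 h).trans h0)

theorem wignerFlip_top_sub_one_coeff_ne_zero {d : ℕ} (hd : 2 ≤ d) :
    (-1 / 2 : ℂ) ^ d * (wignerWeight d d ^ 2 / wignerWeight d (d - 1) / d) ≠ 0 :=
  mul_ne_zero (pow_ne_zero _ (by norm_num)) (div_ne_zero (div_ne_zero
    (pow_ne_zero _ (wignerWeight_ne_zero d d)) (wignerWeight_ne_zero d _))
    (by exact_mod_cast (by omega : d ≠ 0)))

theorem exists_g4_neg_one_eq_vecMul {d : ℕ} (hd : d % 4 = 1) (hd2 : 2 ≤ d) {μ : Fin 3 → ℂ}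
    (hμ : μ = ![((d : ℂ) - 1) / 2, 0, -(((d : ℂ) - 1) / 2)]) :
    ∃ C : ℂ, C ≠ 0 ∧
      g4 d μ (-1) = C • (uVec d 1 d ᵥ* intertwinerW4 d (weylAct weylW5 μ)) := by
  have hodd : Odd d := Nat.odd_iff.mpr (by omega)
  have hκ : Odd ((d + 1) / 2) := Nat.odd_iff.mpr (by omega)
  obtain ⟨η, hη, h⟩ := exists_intertwinerProfile_eq_const hd2 hodd
  refine exists_g4_eq_vecMul_intertwinerW4 (κ := (d + 1) / 2) (ε := 1) (q := fun _ => 1) (τ := 1)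
    (by omega) (by omega) hμ (by simp) (wignerFlip_top_coeff_ne_zero d)
    (fun m hm => by rw [wignerFlip_top d hm, mul_one]) (by simp)
    (by simp [hodd.neg_one_pow, hκ.neg_one_pow]) (by simp [hκ.neg_one_pow]) hη ?_
  rintro n hn hnd ⟨r, hr⟩
  exact h n (by omega) hnd (by rw [Int.odd_iff]; omega)

/-- Now κ is even, while row d with ε = 1 lives on odd indices; row d-1 lives on even ones. There
`intertwinerProfile_id` averages the neighbouring constants η with weights d+n and d-n, giving dη.
-/
theorem exists_g4_one_eq_vecMul {d : ℕ} (hd : d % 4 = 3) {μ : Fin 3 → ℂ}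
    (hμ : μ = ![((d : ℂ) - 1) / 2, 0, -(((d : ℂ) - 1) / 2)]) :
    ∃ C : ℂ, C ≠ 0 ∧
      g4 d μ 1 = C • (uVec d 1 ((d : ℤ) - 1) ᵥ* intertwinerW4 d (weylAct weylW5 μ)) := by
  have hodd : Odd d := Nat.odd_iff.mpr (by omega)
  have hκ : Even ((d + 1) / 2) := Nat.even_iff.mpr (by omega)
  obtain ⟨η, hη, h⟩ := exists_intertwinerProfile_eq_const (by omega) hodd
  refine exists_g4_eq_vecMul_intertwinerW4 (κ := (d + 1) / 2) (ε := 1) (q := fun m => m) (τ := -1)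
    (η := d * η) (by omega) (by omega) hμ (by rw [abs_le]; omega)
    (wignerFlip_top_sub_one_coeff_ne_zero (by omega))
    (fun m hm => wignerFlip_top_sub_one (by omega) hm) (by simp)
    (by simp [hodd.neg_one_pow, hκ.neg_one_pow]) (by simp [hκ.neg_one_pow])
    (mul_ne_zero (by exact_mod_cast (by omega : d ≠ 0)) hη) ?_
  rintro n hn hnd ⟨r, hr⟩
  have h1 := intertwinerProfile_id (d := d) (u := (d : ℂ) - 1) (ε := 1) (n := n)
    (by rw [abs_lt]; omega)
  rw [h (n - 1) (by omega) (by omega) (by rw [Int.odd_iff]; omega),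
    h (n + 1) (by omega) (by omega) (by rw [Int.odd_iff]; omega)] at h1
  linear_combination h1 / 2

theorem mainTheorem6 (d : ℕ) (hd : 2 ≤ d) :
    (∀ t : ℝ, (Even d ∨ t ≠ 0) → ∀ μ : Fin 3 → ℂ,
      μ = ![((d : ℂ) - 1) / 2 + Complex.I * t, -2 * Complex.I * t,
        -(((d : ℂ) - 1) / 2) + Complex.I * t] →
      (∃ C : ℂ, C ≠ 0 ∧ g2 d μ 0 ((-1) ^ d) =
        C • (uVec d ((-1) ^ d) d ᵥ* intertwinerW3 d (weylAct weylW3 μ))) ∧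
      (∃ C : ℂ, C ≠ 0 ∧ g2 d μ 1 (-(-1) ^ d) =
        C • (uVec d (-(-1) ^ d) d ᵥ* intertwinerW3 d (weylAct weylW3 μ)))) ∧
    (d % 4 = 1 → ∀ μ : Fin 3 → ℂ, μ = ![((d : ℂ) - 1) / 2, 0, -(((d : ℂ) - 1) / 2)] →
      (∃ C : ℂ, C ≠ 0 ∧ g2 d μ 0 (-1) =
        C • (uVec d (-1) d ᵥ* intertwinerW3 d (weylAct weylW3 μ))) ∧
      (∃ C : ℂ, C ≠ 0 ∧ g4 d μ 1 =
        C • (uVec d 1 d ᵥ* intertwinerW3 d (weylAct weylW3 μ))) ∧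
      (∃ C : ℂ, C ≠ 0 ∧ g4 d μ (-1) =
        C • (uVec d 1 d ᵥ* intertwinerW4 d (weylAct weylW5 μ)))) ∧
    (d % 4 = 3 → ∀ μ : Fin 3 → ℂ, μ = ![((d : ℂ) - 1) / 2, 0, -(((d : ℂ) - 1) / 2)] →
      (∃ C : ℂ, C ≠ 0 ∧ g2 d μ 1 1 =
        C • (uVec d 1 d ᵥ* intertwinerW3 d (weylAct weylW3 μ))) ∧
      (∃ C : ℂ, C ≠ 0 ∧ g4 d μ (-1) =
        C • (uVec d (-1) d ᵥ* intertwinerW3 d (weylAct weylW3 μ))) ∧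
      (∃ C : ℂ, C ≠ 0 ∧ g4 d μ 1 =
        C • (uVec d 1 ((d : ℤ) - 1) ᵥ* intertwinerW4 d (weylAct weylW5 μ)))) ∧
    (∀ μ : Fin 3 → ℂ, μ = ![(d : ℂ) - 1, 0, 1 - (d : ℂ)] →
      (∃ C : ℂ, C ≠ 0 ∧ g3 d μ 1 ((-1) ^ d) =
        C • (uVec d ((-1) ^ d) ((d : ℤ) - 1) ᵥ* intertwinerW3 d (weylAct weylW3 μ))) ∧
      (∃ C : ℂ, C ≠ 0 ∧ g3 d μ 0 ((-1) ^ d) =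
        C • (uVec d ((-1) ^ d) d ᵥ* intertwinerW3 d (weylAct weylW3 μ)))) := by
  have hdd : ((-1 : ℂ) ^ d) * (-1) ^ d = 1 := by rw [← mul_pow]; simp
  refine ⟨fun t ht μ hμ => ⟨?_, ?_⟩, fun h4 μ hμ => ⟨?_, ?_, ?_⟩, fun h4 μ hμ => ⟨?_, ?_, ?_⟩,
    fun μ hμ => ⟨?_, ?_⟩⟩
  · exact exists_g2_eq_vecMul hd ht hμ (by omega) (by push_cast; rw [hdd, pow_zero])
  · exact exists_g2_eq_vecMul hd ht hμ le_rfl (by push_cast; linear_combination -hdd)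
  · exact exists_g2Coeff_sum_eq_of_odd (κ := (d + 1) / 2) (k := 0) (by omega) (by omega) hμ
      (by simp [(Nat.odd_iff.mpr (by omega) : Odd d).neg_one_pow])
      (Or.inl ⟨by omega, by rw [Int.odd_iff]; omega⟩)
  · exact exists_g2Coeff_sum_eq_of_odd (κ := (d + 1) / 2) (by omega) (by omega) hμ
      (by simp [(Nat.odd_iff.mpr (by omega) : Odd d).neg_one_pow,
        (Nat.odd_iff.mpr (by omega) : Odd ((d + 1) / 2)).neg_one_pow]) (Or.inr rfl)
  · exact exists_g4_neg_one_eq_vecMul h4 hd hμ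
  · exact exists_g2Coeff_sum_eq_of_odd (κ := (d + 1) / 2) (k := 1) (by omega) (by omega) hμ
      (by simp [(Nat.odd_iff.mpr (by omega) : Odd d).neg_one_pow])
      (Or.inl ⟨by omega, by rw [Int.odd_iff]; omega⟩)
  · exact exists_g2Coeff_sum_eq_of_odd (κ := (d + 1) / 2) (by omega) (by omega) hμ
      (by simp [(Nat.odd_iff.mpr (by omega) : Odd d).neg_one_pow,
        (Nat.even_iff.mpr (by omega) : Even ((d + 1) / 2)).neg_one_pow]) (Or.inr rfl)
  · exact exists_g4_one_eq_vecMul h4 hμ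
  · refine exists_g3_eq_vecMul hd le_rfl hμ (q := fun m => m) (by rw [abs_le]; omega)
      (wignerFlip_top_sub_one_coeff_ne_zero hd)
      (fun m hm => wignerFlip_top_sub_one (by omega) hm) (by simp)
      (fun m hm => by exact_mod_cast hm) ?_
    intro m h1 h2 he
    have hcast : ((d : ℂ) - 1) = ((d - 1 : ℕ) : ℂ) := by
      rw [Nat.cast_sub (by omega), Nat.cast_one]
    -- In the parity class of d only m = ±d carry a nonzero Gamma factor, and there the linear
    -- factor vanishes. Both sides of the recurrence are therefore zero, and inserting q(m) = m does
    -- no harm.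
    have hz (m : ℤ) (h : |m| < d) (he : Even (m - d)) : gammaEntry ((d : ℂ) - 1) m = 0 := by
      rw [hcast]
      refine gammaEntry_eq_zero (by omega) (by omega) ?_
      rw [show m + ((d - 1 : ℕ) : ℤ) + 1 = (m - d) + 2 * d by omega]
      exact he.add (even_two_mul _)
    have e1 : ((m : ℂ) + 1 - (d - 1)) * gammaEntry ((d : ℂ) - 1) (m + 2) = 0 := by
      rcases eq_or_lt_of_le h2 with h | h
      · have : (m : ℂ) + 2 = d := by exact_mod_cast congrArg (Int.cast : ℤ → ℂ) h
        rw [show (m : ℂ) + 1 - (d - 1) = 0 by linear_combination this, zero_mul]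
      · rw [hz (m + 2) (by rw [abs_lt]; omega)
          (by rw [show m + 2 - (d : ℤ) = (m - d) + 2 by ring]; exact he.add even_two), mul_zero]
    have e2 : ((m : ℂ) + 1 + (d - 1)) * gammaEntry ((d : ℂ) - 1) m = 0 := by
      rcases eq_or_lt_of_le h1 with h | h
      · have : -(d : ℂ) = m := by exact_mod_cast congrArg (Int.cast : ℤ → ℂ) h
        rw [show (m : ℂ) + 1 + (d - 1) = 0 by linear_combination -this, zero_mul]
      · rw [hz m (by rw [abs_lt]; omega) he, mul_zero]
    push_cast
    linear_combination ((m : ℂ) + 2) * e1 - m * e2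
  · refine exists_g3_eq_vecMul hd (by omega) hμ (q := fun _ => 1) (by simp)
      (wignerFlip_top_coeff_ne_zero d) (fun m hm => by rw [wignerFlip_top d hm, mul_one])
      (by simp) (by simp) ?_
    intro m _ _ _
    rw [one_mul, one_mul]
    refine gammaEntry_add_two ?_ m
    have : (2 : ℝ) ≤ d := by exact_mod_cast hd
    simp
    linarith
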